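/- Write $\mathbb{R}_+=[0,\infty)$. Let $K:\mathbb{R}_+^2\to\mathbb{R}$ be of the form $$K(x,y)=r(x)r(y)+\alpha(x,y),\qquad x,y\ge 0,$$ where $r:\mathbb{R}_+\to\mathbb{R}_+$ and $\alpha:\mathbb{R}_+^2\to\mathbb{R}_+$ are continuous and non-negative, $\alpha$ is symmetric, and, for some constant $A>0$, $\alpha(x,y)\le A\,r(x)r(y)$ for all $(x,y)\in[1,\infty)^2$. Assume moreover that $K$ is strictly subquadratic: for each $R\ge 1$, $$\sup_{x\in[0,R]}\frac{K(x,y)}{y}\longrightarrow 0\quad\text{as } y\to\infty .$$ Let $X_{0,1}=L^1((0,\infty);(1+x)\,dx)$ and let $X_{0,1}^+$ be its cone of (a.e.) non-negative elements. Then for every $f_0\in X_{0,1}^+$ the continuous Redner–Ben-Avraham–Kahng coagulation equation $$\partial_t f(x,t)=\int_0^\infty K(x+y,y)f(x+y,t)f(y,t)\,dy-\int_0^\infty K(x,y)f(x,t)f(y,t)\,dy,\qquad f(\cdot,0)=f_0,$$ has at least one mild solution $f$ on $[0,\infty)$ satisfying $$\int_0^\infty x f(x,t)\,dx\le\int_0^\infty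 x f_0(x)\,dx\qquad\text{for all } t\ge 0 .$$ Here a mild solution on $[0,\infty)$ is a (jointly measurable) function $f$ with $f(\cdot,t)\in X_{0,1}^+$ for all $t\ge0$ such that $f\in C([0,\infty);L^1(0,\infty))\cap L^\infty(0,\infty;X_{0,1})$ and such that, for every $t\ge 0$ and almost every $x>0$, the functions $(y,s)\mapsto K(x,y)f(x,s)f(y,s)$ and $(y,s)\mapsto K(x+y,y)f(x+y,s)f(y,s)$ belong to $L^1((0,\infty)\times(0,t))$ and $$f(x,t)=f_0(x)+\int_0^t\!\int_0^\infty K(x+y,y)f(x+y,s)f(y,s)\,dy\,ds-\int_0^t\!\int_0^\infty K(x,y)f(x,s)f(y,s)\,dy\,ds .$$ -/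

import Mathlib

open MeasureTheory Set Filter Topology

noncomputable section

/-- Lebesgue measure on `(0, ∞)`. -/
def volPos : Measure ℝ := volume.restrict (Ioi (0 : ℝ))

/-- The measure `(1 + x) dx` on `(0, ∞)`. -/
def volPosWeighted : Measure ℝ :=
  volPos.withDensity (fun x => ENNReal.ofReal (1 + x))

/-- The Banach space `L¹(0, ∞)`. -/
abbrev L1Pos : Type := Lp ℝ 1 volPos

/-- The Banach space `X_{0,1} = L¹((0, ∞); (1 + x) dx)`, with its norm `∫ (1 + x) |g x| dx`. -/
abbrev X01 : Type := Lp ℝ 1 volPosWeighted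

/-- `g` represents an element of the positive cone of `X_{0,1}`. -/
def MemX01Pos (g : ℝ → ℝ) : Prop :=
  Integrable g volPosWeighted ∧ ∀ᵐ x ∂volPos, 0 ≤ g x

/-- The half-open time interval `[0, T)`, where `T` may be `⊤`, i.e. infinite. -/
def timeIco (T : EReal) : Set ℝ := {t : ℝ | 0 ≤ t ∧ (t : EReal) < T}

/-- `f` (time first, then size) is a mild solution on `[0, T)` of the continuous
Redner–Ben-Avraham–Kahng coagulation equation
`∂ₜ f(x,t) = ∫₀^∞ K(x+y,y) f(x+y,t) f(y,t) dy - ∫₀^∞ K(x,y) f(x,t) f(y,t) dy`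
with initial datum `f₀`.  The function `f t` is a representative of an element of `X_{0,1}`;
the representatives at different times are chosen so that `f` is jointly measurable, so that
the integrals in time and size are meaningful. -/
structure IsMildSolution (K : ℝ → ℝ → ℝ) (f₀ : ℝ → ℝ) (T : EReal) (f : ℝ → ℝ → ℝ) : Prop where
  aestronglyMeasurable :
    AEStronglyMeasurable (Function.uncurry f) ((volume.restrict (timeIco T)).prod volPos)
  /-- `f` takes values in the positive cone of `X_{0,1}`. -/
  mem_pos : ∀ t ∈ timeIco T, MemX01Pos (f t)
  /-- `f ∈ C([0, T); L¹(0, ∞))`. -/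
  continuous_L1 : ∃ F : ℝ → L1Pos,
    (∀ t ∈ timeIco T, F t =ᵐ[volPos] f t) ∧ ContinuousOn F (timeIco T)
  /-- `f ∈ L^∞(0, T; X_{0,1})`. -/
  bounded_X01 : ∃ F : ℝ → X01,
    (∀ t ∈ timeIco T, F t =ᵐ[volPosWeighted] f t) ∧
      MemLp F ⊤ (volume.restrict (timeIco T))
  /-- For almost every size `x`, the loss term is integrable in `(y, s) ∈ (0, ∞) × (0, t)`. -/
  integrable_loss : ∀ t ∈ timeIco T, ∀ᵐ x ∂volPos,
    Integrable (fun p : ℝ × ℝ => K x p.1 * f p.2 x * f p.2 p.1)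
      (volPos.prod (volume.restrict (Ioo 0 t)))
  /-- For almost every size `x`, the gain term is integrable in `(y, s) ∈ (0, ∞) × (0, t)`. -/
  integrable_gain : ∀ t ∈ timeIco T, ∀ᵐ x ∂volPos,
    Integrable (fun p : ℝ × ℝ => K (x + p.1) p.1 * f p.2 (x + p.1) * f p.2 p.1)
      (volPos.prod (volume.restrict (Ioo 0 t)))
  /-- The integrated equation. -/
  mild_eq : ∀ t ∈ timeIco T, ∀ᵐ x ∂volPos,
    f t x = f₀ x
      + (∫ s in Ioo 0 t, ∫ y in Ioi 0, K (x + y) y * f s (x + y) * f s y)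
      - (∫ s in Ioo 0 t, ∫ y in Ioi 0, K x y * f s x * f s y)

end

/-!
The solution is a limit of explicit Euler schemes, compact in the *strong* topology of `L¹`.

Write `w x = 1 + x`. The hypotheses enter only through `K x y / (w x * w y) → 0` at infinity in the
quadrant (`kernel_le_of_subquadratic`). By continuity, `K` is then bounded by a constant plus
`ε w(x) w(y)` for every `ε > 0`, and `|K (x + h) y - K x y| ≤ ε w(x) w(y)` for small `h`
(`ControlledKernel`).

For the kernel cut off at height `n` and a time step short enough to keep the density non-negative,
three estimates hold uniformly in `n`.

* Collisions replace sizes `z > y` by `z - y`, so moments with non-decreasing weights, in particular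
  number and mass, do not increase (`eulerStep_moment_le`).
* The scheme is Lipschitz continuous in time with values in `L¹`, up to the time step
  (`eulerStep_dist_le`).
* The translation defect `∫ |f (x + h) - f x|` grows at most linearly in time, at a rate that tends
  to `0` with `h` (`eulerStep_shift_le`). The gain term contributes to this defect at most the
  integral of `K(z, y) |f (z + h) - f z| f(y)` over `z > y`, and the loss term removes the same
  integral over all pairs; only the oscillation of the kernel remains.

A Kolmogorov–Riesz argument (`totallyBounded_of_shift`) and a diagonal extraction give a subsequence
that converges in `L¹` at every time (`exists_limit_eulerApprox`). The part of the kernel above a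
high level is dominated by `ε w(x) w(y)`, whose collision integral is at most `ε (∫ w f) ^ 2`, so the
collision integrals converge (`abs_weakRate_trunc_sub_le`). The limit satisfies the equation
integrated over every measurable set of sizes (`exists_weak_solution`), and Fubini's theorem turns
this into the equation at almost every size (`mild_of_weak`).
-/

/-! ### Controlled kernels -/

/-- Kernels for which the equation is solved below: non-negative, dominated by a constant plus an
arbitrarily small multiple of `(1 + x) (1 + y)`, and uniformly continuous in the first variable
relative to that weight. -/
structure ControlledKernel (K : ℝ → ℝ → ℝ) : Prop where
  measurable : Measurable (Function.uncurry K)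
  nonneg : ∀ x y, 0 ≤ K x y
  le_add : ∀ ε > 0, ∃ m : ℝ, 0 ≤ m ∧ ∀ x > 0, ∀ y > 0, K x y ≤ m + ε * ((1 + x) * (1 + y))
  modulus : ∀ ε > 0, ∃ δ > 0, ∀ h, 0 < h → h < δ → ∀ x > 0, ∀ y > 0,
    |K (x + h) y - K x y| ≤ ε * ((1 + x) * (1 + y))

/-- A continuous kernel on the closed quadrant that is `o((1 + x) (1 + y))` at infinity is
controlled, once it is extended to the plane by clipping its arguments at `0`. -/
theorem ControlledKernel.of_continuousOn {K : ℝ → ℝ → ℝ}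
    (hcont : ContinuousOn (Function.uncurry K) (Ici 0 ×ˢ Ici 0))
    (hnonneg : ∀ x, 0 ≤ x → ∀ y, 0 ≤ y → 0 ≤ K x y)
    (hinf : ∀ ε > 0, ∃ R : ℝ, ∀ x, 0 ≤ x → ∀ y, 0 ≤ y → (R ≤ x ∨ R ≤ y) →
      K x y ≤ ε * ((1 + x) * (1 + y))) :
    ControlledKernel (fun x y => K (max x 0) (max y 0)) := by
  have hc : Continuous (Function.uncurry (fun x y => K (max x 0) (max y 0))) := by
    have : Continuous (fun p : ℝ × ℝ => (max p.1 0, max p.2 0)) := by fun_prop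
    exact hcont.comp_continuous this fun p =>
      ⟨mem_Ici.2 (le_max_right _ _), mem_Ici.2 (le_max_right _ _)⟩
  refine ⟨hc.measurable, fun x y => hnonneg _ (le_max_right _ _) _ (le_max_right _ _), ?_, ?_⟩
  · intro ε hε
    obtain ⟨R, hR⟩ := hinf ε hε
    have hcpt : IsCompact (Icc (0 : ℝ) R ×ˢ Icc (0 : ℝ) R) := isCompact_Icc.prod isCompact_Icc
    obtain ⟨m, hm⟩ := hcpt.bddAbove_image hc.continuousOn
    refine ⟨max m 0, le_max_right _ _, fun x hx y hy => ?_⟩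
    have hp : 0 ≤ ε * ((1 + x) * (1 + y)) := by positivity
    by_cases h : R ≤ x ∨ R ≤ y
    · have := hR x hx.le y hy.le h
      simp only [max_eq_left hx.le, max_eq_left hy.le]
      linarith [le_max_right m 0]
    · push Not at h
      have := hm ⟨(x, y), ⟨⟨hx.le, h.1.le⟩, ⟨hy.le, h.2.le⟩⟩, rfl⟩
      simp only [Function.uncurry] at this
      linarith [le_max_left m 0]
  · intro ε hε
    obtain ⟨R, hR⟩ := hinf (ε / 3) (by positivity)
    have hcpt : IsCompact (Icc (0 : ℝ) (R + 1) ×ˢ Icc (0 : ℝ) (R + 1)) :=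
      isCompact_Icc.prod isCompact_Icc
    have huc := hcpt.uniformContinuousOn_of_continuous hc.continuousOn
    obtain ⟨δ, hδ, hd⟩ := Metric.uniformContinuousOn_iff.1 huc ε hε
    refine ⟨min δ 1, by positivity, fun h h0 h1 x hx y hy => ?_⟩
    have hhδ : h < δ := h1.trans_le (min_le_left _ _)
    have hh1 : h < 1 := h1.trans_le (min_le_right _ _)
    have hxh : 0 ≤ x + h := by linarith
    by_cases hc : R ≤ x ∨ R ≤ y
    · have e1 := hR x hx.le y hy.le hc
      have e2 := hR (x + h) hxh y hy.le (hc.imp (fun h' => by linarith) id)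
      have e3 := hnonneg x hx.le y hy.le
      have e4 := hnonneg (x + h) hxh y hy.le
      simp only [max_eq_left hx.le, max_eq_left hy.le, max_eq_left hxh]
      have e5 : ε / 3 * ((1 + (x + h)) * (1 + y)) ≤ ε / 3 * ((2 * (1 + x)) * (1 + y)) := by
        gcongr; linarith
      rw [abs_le]
      constructor <;> nlinarith
    · push Not at hc
      have := hd (x + h, y) ⟨⟨hxh, by linarith⟩, ⟨hy.le, by linarith⟩⟩ (x, y)
        ⟨⟨hx.le, by linarith⟩, ⟨hy.le, by linarith⟩⟩ (by
          simp [Prod.dist_eq, abs_of_pos h0, hhδ, hδ])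
      rw [Real.dist_eq] at this
      refine this.le.trans ?_
      have : 1 ≤ (1 + x) * (1 + y) := by nlinarith
      nlinarith

theorem ControlledKernel.exists_le_mul {K : ℝ → ℝ → ℝ} (hK : ControlledKernel K) :
    ∃ C : ℝ, 0 ≤ C ∧ ∀ x > 0, ∀ y > 0, K x y ≤ C * ((1 + x) * (1 + y)) := by
  obtain ⟨m, hm0, hm⟩ := hK.le_add 1 one_pos
  refine ⟨m + 1, by positivity, fun x hx y hy => (hm x hx y hy).trans ?_⟩
  have : 1 ≤ (1 + x) * (1 + y) := by nlinarith
  nlinarith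

/-- The product-type structure for large sizes, together with strict subquadraticity in one
variable, makes the kernel negligible against `(1 + x) (1 + y)` at infinity. -/
theorem kernel_le_of_subquadratic {K : ℝ → ℝ → ℝ} {r : ℝ → ℝ} {α : ℝ → ℝ → ℝ} {A : ℝ}
    (hK : ∀ x, 0 ≤ x → ∀ y, 0 ≤ y → K x y = r x * r y + α x y)
    (hr_cont : ContinuousOn r (Ici 0)) (hr_nonneg : ∀ x, 0 ≤ x → 0 ≤ r x)
    (hcont : ContinuousOn (Function.uncurry K) (Ici 0 ×ˢ Ici 0))
    (hα_nonneg : ∀ x, 0 ≤ x → ∀ y, 0 ≤ y → 0 ≤ α x y)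
    (hα_symm : ∀ x, 0 ≤ x → ∀ y, 0 ≤ y → α x y = α y x)
    (hA : 0 < A) (hα_le : ∀ x, 1 ≤ x → ∀ y, 1 ≤ y → α x y ≤ A * r x * r y)
    (hK_sub : ∀ R : ℝ, 1 ≤ R →
      Tendsto (fun y : ℝ => sSup ((fun x : ℝ => K x y / y) '' Icc 0 R)) atTop (𝓝 0)) :
    ∀ ε > 0, ∃ R : ℝ, ∀ x, 0 ≤ x → ∀ y, 0 ≤ y → (R ≤ x ∨ R ≤ y) →
      K x y ≤ ε * ((1 + x) * (1 + y)) := by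
  have hsymm : ∀ x, 0 ≤ x → ∀ y, 0 ≤ y → K x y = K y x := fun x hx y hy => by
    rw [hK x hx y hy, hK y hy x hx, hα_symm x hx y hy, mul_comm]
  have hsub : ∀ R : ℝ, 1 ≤ R → ∀ ε > 0, ∃ Y : ℝ, 1 ≤ Y ∧ ∀ y ≥ Y, ∀ x, 0 ≤ x → x ≤ R →
      K x y ≤ ε * y := by
    intro R hR ε hε
    obtain ⟨Y, hY⟩ := eventually_atTop.1 ((hK_sub R hR).eventually (gt_mem_nhds hε))
    refine ⟨max Y 1, le_max_right _ _, fun y hy x hx hxR => ?_⟩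
    have hy1 : 1 ≤ y := (le_max_right _ _).trans hy
    have hcy : ContinuousOn (fun x : ℝ => K x y / y) (Icc 0 R) := by
      refine ContinuousOn.div_const ?_ _
      exact hcont.comp (f := fun x : ℝ => (x, y)) (by fun_prop)
        fun x hx => ⟨hx.1, show (0 : ℝ) ≤ y by linarith⟩
    have h1 := le_csSup (isCompact_Icc.bddAbove_image hcy) (mem_image_of_mem _ ⟨hx, hxR⟩)
    have h2 := h1.trans (hY y ((le_max_left _ _).trans hy)).le
    exact (div_le_iff₀ (by linarith)).1 h2
  have hr_small : ∀ ε > 0, ∃ Y : ℝ, 1 ≤ Y ∧ ∀ y ≥ Y, r y ≤ ε * y := by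
    intro ε hε
    by_cases hr : ∃ x, 0 ≤ x ∧ 0 < r x
    · obtain ⟨x, hx, hrx⟩ := hr
      obtain ⟨Y, hY1, hY⟩ := hsub (max 1 x) (le_max_left _ _) (ε * r x) (by positivity)
      refine ⟨Y, hY1, fun y hy => ?_⟩
      have h1 := hY y hy x hx (le_max_right _ _)
      have hy0 : 0 ≤ y := by linarith
      rw [hK x hx y hy0] at h1
      have h2 := hα_nonneg x hx y hy0
      by_contra hcon
      push Not at hcon
      nlinarith
    · push Not at hr
      refine ⟨1, le_rfl, fun y hy => (hr y (by linarith)).trans ?_⟩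
      have : 0 ≤ y := by linarith
      positivity
  obtain ⟨B, hB0, hB⟩ : ∃ B : ℝ, 0 < B ∧ ∀ x, 0 ≤ x → r x ≤ B * (1 + x) := by
    obtain ⟨Y, hY1, hY⟩ := hr_small 1 one_pos
    obtain ⟨m, hm⟩ := (isCompact_Icc (a := (0 : ℝ)) (b := Y)).bddAbove_image
      (hr_cont.mono fun x hx => hx.1)
    refine ⟨max m 1, by positivity, fun x hx => ?_⟩
    have h1 : 1 ≤ max m 1 := le_max_right _ _
    rcases le_total x Y with h | h
    · have h2 : r x ≤ max m 1 := (hm ⟨x, ⟨hx, h⟩, rfl⟩).trans (le_max_left _ _)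
      nlinarith
    · have := hY x h
      nlinarith
  intro ε hε
  obtain ⟨Y₁, hY₁, h₁⟩ := hsub 1 le_rfl ε hε
  obtain ⟨Y₂, hY₂, h₂⟩ := hr_small (ε / ((1 + A) * B)) (by positivity)
  have key : ∀ x, 0 ≤ x → ∀ y, 0 ≤ y → max Y₁ Y₂ ≤ y → K x y ≤ ε * ((1 + x) * (1 + y)) := by
    intro x hx y hy hYy
    have hy1 : Y₁ ≤ y := (le_max_left _ _).trans hYy
    have hy2 : Y₂ ≤ y := (le_max_right _ _).trans hYy
    rcases le_total x 1 with h | h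
    · refine (h₁ y hy1 x hx h).trans ?_
      gcongr
      nlinarith
    · have e1 := hα_le x h y (by linarith)
      have e2 := hB x hx
      have e3 := h₂ y hy2
      have e4 := hr_nonneg x hx
      have e5 := hr_nonneg y hy
      rw [hK x hx y hy]
      calc r x * r y + α x y ≤ (1 + A) * (r x * r y) := by linarith
        _ ≤ (1 + A) * ((B * (1 + x)) * (ε / ((1 + A) * B) * y)) := by gcongr
        _ = ε * ((1 + x) * y) := by field_simp
        _ ≤ ε * ((1 + x) * (1 + y)) := by gcongr; linarith
  refine ⟨max Y₁ Y₂, fun x hx y hy h => ?_⟩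
  rcases h with h | h
  · rw [hsymm x hx y hy, mul_comm (1 + x)]
    exact key y hy x hx h
  · exact key x hx y hy h

/-! ### Collision integrals and one Euler step -/

theorem ae_volPos_pos : ∀ᵐ x ∂volPos, 0 < x := ae_restrict_mem measurableSet_Ioi

instance : SFinite volPos := by unfold volPos; infer_instance

theorem ae_prod_volPos_pos : ∀ᵐ p ∂(volPos.prod volPos), 0 < p.1 ∧ 0 < p.2 := by
  unfold volPos
  rw [Measure.prod_restrict]
  exact ae_restrict_mem (measurableSet_Ioi.prod measurableSet_Ioi)

theorem measurePreserving_shift (h : ℝ) :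
    MeasurePreserving (fun x : ℝ => x + h) volPos (volume.restrict (Ioi h)) := by
  have := (measurePreserving_add_right volume h).restrict_preimage (measurableSet_Ioi (a := h))
  simpa [volPos] using this

theorem measurableEmbedding_shift (h : ℝ) : MeasurableEmbedding (fun x : ℝ => x + h) :=
  (MeasurableEquiv.addRight h).measurableEmbedding

theorem ae_volPos_shift {h : ℝ} (hh : 0 ≤ h) {p : ℝ → Prop} (hp : ∀ᵐ x ∂volPos, p x) :
    ∀ᵐ x ∂volPos, p (x + h) :=
  (measurePreserving_shift h).quasiMeasurePreserving.ae
    (ae_mono (Measure.restrict_mono (Ioi_subset_Ioi hh) le_rfl) hp)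

theorem integrable_shift {h : ℝ} (hh : 0 ≤ h) {u : ℝ → ℝ} (hu : Integrable u volPos) :
    Integrable (fun x => u (x + h)) volPos :=
  ((measurePreserving_shift h).integrable_comp_emb (measurableEmbedding_shift h)).2
    (hu.mono_measure (Measure.restrict_mono (Ioi_subset_Ioi hh) le_rfl))

theorem integral_shift_le {h : ℝ} (hh : 0 ≤ h) {u : ℝ → ℝ} (hu : Integrable u volPos)
    (h0 : 0 ≤ᵐ[volPos] u) : ∫ x, u (x + h) ∂volPos ≤ ∫ x, u x ∂volPos := by
  rw [(measurePreserving_shift h).integral_comp (measurableEmbedding_shift h)]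
  exact integral_mono_measure (Measure.restrict_mono (Ioi_subset_Ioi hh) le_rfl) h0 hu

/-- The pairs of sizes `(z, y)` whose first entry is the larger one; they produce size `z - y`. -/
def largerFirst : Set (ℝ × ℝ) := {p | p.2 < p.1}

theorem measurableSet_largerFirst : MeasurableSet largerFirst :=
  measurableSet_lt measurable_snd measurable_fst

theorem measurableEmbedding_shear :
    MeasurableEmbedding (fun p : ℝ × ℝ => (p.1 + p.2, p.2)) := by
  let e : ℝ × ℝ ≃ᵐ ℝ × ℝ :=
    { toFun := fun p => (p.1 + p.2, p.2)
      invFun := fun p => (p.1 - p.2, p.2)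
      left_inv := fun p => by simp
      right_inv := fun p => by simp
      measurable_toFun := by simp only [Equiv.coe_fn_mk]; fun_prop
      measurable_invFun := by simp only [Equiv.coe_fn_symm_mk]; fun_prop }
  exact e.measurableEmbedding

/-- The change of variables `(x, y) ↦ (x + y, y)` that turns the gain term into a double integral
over pairs of colliding sizes. -/
theorem measurePreserving_shear :
    MeasurePreserving (fun p : ℝ × ℝ => (p.1 + p.2, p.2)) (volPos.prod volPos)
      ((volPos.prod volPos).restrict largerFirst) := by
  have h0 : MeasurePreserving (fun p : ℝ × ℝ => (p.1 + p.2, p.2))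
      ((volume : Measure ℝ).prod volume) ((volume : Measure ℝ).prod volume) := by
    have := (Measure.measurePreserving_swap (μ := (volume : Measure ℝ))
      (ν := (volume : Measure ℝ))).comp
      (measurePreserving_prod_add_swap (volume : Measure ℝ) (volume : Measure ℝ))
    simpa [Function.comp_def, add_comm] using this
  have hs : MeasurableSet (largerFirst ∩ (Ioi (0 : ℝ) ×ˢ Ioi (0 : ℝ))) :=
    measurableSet_largerFirst.inter (measurableSet_Ioi.prod measurableSet_Ioi)
  have h1 := h0.restrict_preimage hs
  unfold volPos
  rw [Measure.prod_restrict, Measure.restrict_restrict measurableSet_largerFirst]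
  convert h1 using 2
  ext ⟨x, y⟩
  simp only [largerFirst, mem_prod, mem_Ioi, mem_preimage, mem_inter_iff, mem_ofPred_eq]
  constructor
  · rintro ⟨hx, hy⟩
    exact ⟨by linarith, by linarith, hy⟩
  · rintro ⟨h1, -, hy⟩
    exact ⟨by linarith, hy⟩

theorem integrable_shear {H : ℝ × ℝ → ℝ} (h : Integrable H (volPos.prod volPos)) :
    Integrable (fun p : ℝ × ℝ => H (p.1 + p.2, p.2)) (volPos.prod volPos) :=
  (measurePreserving_shear.integrable_comp_emb measurableEmbedding_shear).2 h.integrableOn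

theorem integral_shear (H : ℝ × ℝ → ℝ) :
    ∫ p, H (p.1 + p.2, p.2) ∂(volPos.prod volPos) = ∫ p in largerFirst, H p ∂(volPos.prod volPos) :=
  measurePreserving_shear.integral_comp measurableEmbedding_shear H

theorem integral_shear_le {H : ℝ × ℝ → ℝ} (h : Integrable H (volPos.prod volPos))
    (h0 : 0 ≤ H) :
    ∫ p, H (p.1 + p.2, p.2) ∂(volPos.prod volPos) ≤ ∫ p, H p ∂(volPos.prod volPos) := by
  rw [integral_shear]
  exact setIntegral_le_integral h (ae_of_all _ h0)

/-- The rate at which a particle of size `x` is consumed in a population with density `f`. -/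
noncomputable def lossRate (K : ℝ → ℝ → ℝ) (f : ℝ → ℝ) (x : ℝ) : ℝ :=
  ∫ y, K x y * f y ∂volPos

/-- The rate at which collisions of a larger particle from the density `g` with a smaller one from
`f` produce particles of size `x`. Keeping `g` and `f` apart makes the gain bilinear. -/
noncomputable def gain (K : ℝ → ℝ → ℝ) (g f : ℝ → ℝ) (x : ℝ) : ℝ :=
  ∫ y, K (x + y) y * g (x + y) * f y ∂volPos

/-- One explicit Euler step of length `τ`, with the loss term collected into a factor that is
non-negative for small `τ`. -/
noncomputable def eulerStep (K : ℝ → ℝ → ℝ) (τ : ℝ) (f : ℝ → ℝ) (x : ℝ) : ℝ :=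
  f x * (1 - τ * lossRate K f x) + τ * gain K f f x

section Collision

variable {K : ℝ → ℝ → ℝ} {g f : ℝ → ℝ}

theorem integrable_gain
    (h : Integrable (fun p : ℝ × ℝ => K p.1 p.2 * g p.1 * f p.2) (volPos.prod volPos)) :
    Integrable (gain K g f) volPos :=
  (integrable_shear h).integral_prod_left

theorem ae_integrable_gain
    (h : Integrable (fun p : ℝ × ℝ => K p.1 p.2 * g p.1 * f p.2) (volPos.prod volPos)) :
    ∀ᵐ x ∂volPos, Integrable (fun y => K (x + y) y * g (x + y) * f y) volPos :=
  (integrable_shear h).prod_right_ae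

theorem integral_gain_le
    (h : Integrable (fun p : ℝ × ℝ => K p.1 p.2 * g p.1 * f p.2) (volPos.prod volPos))
    (h0 : ∀ x y, 0 ≤ K x y * g x * f y) :
    ∫ x, gain K g f x ∂volPos ≤ ∫ p, K p.1 p.2 * g p.1 * f p.2 ∂(volPos.prod volPos) := by
  have := integral_shear_le h (fun p => h0 p.1 p.2)
  rwa [integral_prod _ (integrable_shear h)] at this

theorem integrable_mul_lossRate
    (h : Integrable (fun p : ℝ × ℝ => K p.1 p.2 * g p.1 * f p.2) (volPos.prod volPos)) :
    Integrable (fun x => g x * lossRate K f x) volPos := by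
  refine h.integral_prod_left.congr (ae_of_all _ fun x => ?_)
  simp only [lossRate, ← integral_const_mul]
  exact integral_congr_ae (ae_of_all _ fun y => by ring)

theorem integral_mul_lossRate
    (h : Integrable (fun p : ℝ × ℝ => K p.1 p.2 * g p.1 * f p.2) (volPos.prod volPos)) :
    ∫ x, g x * lossRate K f x ∂volPos
      = ∫ p, K p.1 p.2 * g p.1 * f p.2 ∂(volPos.prod volPos) := by
  rw [integral_prod _ h]
  refine integral_congr_ae (ae_of_all _ fun x => ?_)
  simp only [lossRate, ← integral_const_mul]
  exact integral_congr_ae (ae_of_all _ fun y => by ring)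

theorem measurable_lossRate (hK : Measurable (Function.uncurry K)) (hf : Measurable f) :
    Measurable (lossRate K f) := by
  have : Measurable (fun p : ℝ × ℝ => K p.1 p.2 * f p.2) :=
    Measurable.mul hK (hf.comp measurable_snd)
  exact this.stronglyMeasurable.integral_prod_right'.measurable

theorem measurable_gain (hK : Measurable (Function.uncurry K)) (hg : Measurable g)
    (hf : Measurable f) : Measurable (gain K g f) := by
  have : Measurable (fun p : ℝ × ℝ => K (p.1 + p.2) p.2 * g (p.1 + p.2) * f p.2) :=
    ((hK.comp (by fun_prop : Measurable fun p : ℝ × ℝ => (p.1 + p.2, p.2))).mul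
      (hg.comp (by fun_prop))).mul (hf.comp measurable_snd)
  exact this.stronglyMeasurable.integral_prod_right'.measurable

theorem lossRate_nonneg (hK : ∀ x y, 0 ≤ K x y) (hf : ∀ x, 0 ≤ f x) (x : ℝ) :
    0 ≤ lossRate K f x :=
  integral_nonneg fun y => mul_nonneg (hK x y) (hf y)

theorem gain_nonneg (hK : ∀ x y, 0 ≤ K x y) (hg : ∀ x, 0 ≤ g x) (hf : ∀ x, 0 ≤ f x) (x : ℝ) :
    0 ≤ gain K g f x :=
  integral_nonneg fun y => mul_nonneg (mul_nonneg (hK _ _) (hg _)) (hf y)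

end Collision

/-- A bounded, measurable, non-negative kernel. -/
structure BoundedKernel (K : ℝ → ℝ → ℝ) (N : ℝ) : Prop where
  measurable : Measurable (Function.uncurry K)
  nonneg : ∀ x y, 0 ≤ K x y
  le : ∀ x y, K x y ≤ N

namespace BoundedKernel

variable {K : ℝ → ℝ → ℝ} {N : ℝ} {g f : ℝ → ℝ}

theorem bound_nonneg (hK : BoundedKernel K N) : 0 ≤ N := (hK.nonneg 0 0).trans (hK.le 0 0)

theorem integrable_collision (hK : BoundedKernel K N) (hg : Integrable g volPos)
    (hf : Integrable f volPos) :
    Integrable (fun p : ℝ × ℝ => K p.1 p.2 * g p.1 * f p.2) (volPos.prod volPos) := by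
  have h1 : Integrable (fun p : ℝ × ℝ => g p.1 * f p.2) (volPos.prod volPos) := hg.mul_prod hf
  have h2 := h1.bdd_mul (f := fun p : ℝ × ℝ => K p.1 p.2) (c := N)
    hK.measurable.aestronglyMeasurable
    (ae_of_all _ fun p => by rw [Real.norm_of_nonneg (hK.nonneg _ _)]; exact hK.le _ _)
  exact h2.congr (ae_of_all _ fun p => by simp only []; ring)

theorem lossRate_le (hK : BoundedKernel K N) (hf0 : ∀ x, 0 ≤ f x)
    (hf : Integrable f volPos) (x : ℝ) : lossRate K f x ≤ N * ∫ y, f y ∂volPos := by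
  rw [← integral_const_mul]
  exact integral_mono_of_nonneg (ae_of_all _ fun y => mul_nonneg (hK.nonneg x y) (hf0 y))
    (hf.const_mul N) (ae_of_all _ fun y => mul_le_mul_of_nonneg_right (hK.le x y) (hf0 y))

end BoundedKernel

theorem eulerStep_nonneg {K : ℝ → ℝ → ℝ} {N τ : ℝ} {f : ℝ → ℝ} (hK : BoundedKernel K N)
    (hτ : 0 ≤ τ) (hf0 : ∀ x, 0 ≤ f x) (hf : Integrable f volPos)
    (hτf : τ * (N * ∫ y, f y ∂volPos) ≤ 1) (x : ℝ) : 0 ≤ eulerStep K τ f x := by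
  have h1 := mul_le_mul_of_nonneg_left (hK.lossRate_le hf0 hf x) hτ
  have h2 := gain_nonneg hK.nonneg hf0 hf0 x
  unfold eulerStep
  have h3 := mul_nonneg (hf0 x) (by linarith : 0 ≤ 1 - τ * lossRate K f x)
  have h4 := mul_nonneg hτ h2
  linarith

theorem measurable_eulerStep {K : ℝ → ℝ → ℝ} {τ : ℝ} {f : ℝ → ℝ}
    (hK : Measurable (Function.uncurry K)) (hf : Measurable f) :
    Measurable (eulerStep K τ f) :=
  (hf.mul (measurable_const.sub (measurable_const.mul (measurable_lossRate hK hf)))).add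
    (measurable_const.mul (measurable_gain hK hf hf))

/-- A collision replaces sizes `z > y` by `z - y`, so an Euler step does not increase moments with
non-negative, non-decreasing weights. -/
theorem eulerStep_moment_le {K : ℝ → ℝ → ℝ} {N τ : ℝ} {f φ : ℝ → ℝ} (hK : BoundedKernel K N)
    (hτ : 0 ≤ τ) (hfm : Measurable f) (hf0 : ∀ x, 0 ≤ f x) (hf : Integrable f volPos)
    (hφm : Measurable φ) (hφ0 : ∀ x, 0 < x → 0 ≤ φ x) (hφ : MonotoneOn φ (Ioi 0))
    (hφf : Integrable (fun x => φ x * f x) volPos) :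
    Integrable (fun x => φ x * eulerStep K τ f x) volPos ∧
      ∫ x, φ x * eulerStep K τ f x ∂volPos ≤ ∫ x, φ x * f x ∂volPos := by
  have hc := hK.integrable_collision hφf hf
  have hL := integrable_mul_lossRate (g := fun x => φ x * f x) hc
  have hG := integrable_gain (g := fun x => φ x * f x) hc
  have hle : ∀ᵐ x ∂volPos, φ x * gain K f f x ≤ gain K (fun z => φ z * f z) f x := by
    filter_upwards [ae_integrable_gain (g := fun x => φ x * f x) hc, ae_volPos_pos] with x hx hx0
    unfold gain
    rw [← integral_const_mul]
    refine integral_mono_of_nonneg ?_ hx ?_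
    · exact ae_of_all _ fun y =>
        mul_nonneg (hφ0 x hx0) (mul_nonneg (mul_nonneg (hK.nonneg _ _) (hf0 _)) (hf0 _))
    · filter_upwards [ae_volPos_pos] with y hy
      have h1 : φ x ≤ φ (x + y) := hφ hx0 (mem_Ioi.2 (by linarith)) (by linarith)
      have h2 := mul_nonneg (mul_nonneg (hK.nonneg (x + y) y) (hf0 (x + y))) (hf0 y)
      calc φ x * (K (x + y) y * f (x + y) * f y)
          ≤ φ (x + y) * (K (x + y) y * f (x + y) * f y) := mul_le_mul_of_nonneg_right h1 h2
        _ = _ := by ring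
  have hG' : Integrable (fun x => φ x * gain K f f x) volPos := by
    refine hG.mono' (hφm.mul (measurable_gain hK.measurable hfm hfm)).aestronglyMeasurable ?_
    filter_upwards [hle, ae_volPos_pos] with x hx hx0
    rw [Real.norm_of_nonneg (mul_nonneg (hφ0 x hx0) (gain_nonneg hK.nonneg hf0 hf0 x))]
    exact hx
  have heq : (fun x => φ x * eulerStep K τ f x) = fun x =>
      φ x * f x - τ * (φ x * f x * lossRate K f x) + τ * (φ x * gain K f f x) := by
    ext x; simp only [eulerStep]; ring
  rw [heq]
  have hD : Integrable (fun x => φ x * f x - τ * (φ x * f x * lossRate K f x)) volPos :=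
    hφf.sub (hL.const_mul τ)
  refine ⟨hD.add (hG'.const_mul τ), ?_⟩
  rw [integral_add hD (hG'.const_mul τ),
    integral_sub hφf (hL.const_mul τ), integral_const_mul, integral_const_mul,
    integral_mul_lossRate (g := fun x => φ x * f x) hc]
  have h1 : ∫ x, φ x * gain K f f x ∂volPos
      ≤ ∫ p, K p.1 p.2 * (φ p.1 * f p.1) * f p.2 ∂(volPos.prod volPos) := by
    refine (integral_mono_ae hG' hG hle).trans ?_
    -- the weight is only signed on positive sizes, so the sign is checked almost everywhere
    have h2 : ∫ x, gain K (fun z => φ z * f z) f x ∂volPos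
        = ∫ p in largerFirst, K p.1 p.2 * (φ p.1 * f p.1) * f p.2 ∂(volPos.prod volPos) := by
      rw [← integral_shear (fun p => K p.1 p.2 * (φ p.1 * f p.1) * f p.2),
        integral_prod _ (integrable_shear hc)]
      rfl
    rw [h2]
    refine setIntegral_le_integral hc ?_
    filter_upwards [ae_prod_volPos_pos] with p hp
    exact mul_nonneg (mul_nonneg (hK.nonneg _ _) (mul_nonneg (hφ0 _ hp.1) (hf0 _))) (hf0 _)
  nlinarith [mul_le_mul_of_nonneg_left h1 hτ]

/-- The loss of `|u (x + h) - u x|` compensates its gain exactly, so an Euler step only increases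
the `L¹` translation defect by the oscillation of the kernel. -/
theorem eulerStep_shift_le {K : ℝ → ℝ → ℝ} {N τ h ω : ℝ} {f : ℝ → ℝ} (hK : BoundedKernel K N)
    (hτ : 0 ≤ τ) (hh : 0 ≤ h) (hω : 0 ≤ ω) (hf0 : ∀ x, 0 ≤ f x)
    (hf : Integrable f volPos) (hwf : Integrable (fun x => (1 + x) * f x) volPos)
    (hτf : τ * (N * ∫ y, f y ∂volPos) ≤ 1)
    (hmod : ∀ x > 0, ∀ y > 0, |K (x + h) y - K x y| ≤ ω * ((1 + x) * (1 + y))) :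
    ∫ x, |eulerStep K τ f (x + h) - eulerStep K τ f x| ∂volPos ≤
      ∫ x, |f (x + h) - f x| ∂volPos + 2 * τ * ω * (∫ x, (1 + x) * f x ∂volPos) ^ 2 := by
  set M := ∫ x, (1 + x) * f x ∂volPos with hM
  -- the weighted shifted density `u` and weighted density `v` carry the oscillation of the kernel
  set d : ℝ → ℝ := fun x => |f (x + h) - f x| with hd
  set u : ℝ → ℝ := fun x => (1 + x) * f (x + h) with hu
  set v : ℝ → ℝ := fun x => (1 + x) * f x with hv
  have hfh := integrable_shift hh hf
  have hfhm := hfh.aestronglyMeasurable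
  have hd_int : Integrable d volPos := (hfh.sub hf).abs
  have hu_le : ∀ᵐ x ∂volPos, 0 ≤ u x ∧ u x ≤ v (x + h) := by
    filter_upwards [ae_volPos_pos] with x hx
    refine ⟨mul_nonneg (by linarith) (hf0 _), ?_⟩
    exact mul_le_mul_of_nonneg_right (by linarith) (hf0 _)
  have hvh := integrable_shift hh hwf
  have hu_int : Integrable u volPos := by
    refine hvh.mono' ((by fun_prop : Measurable fun x : ℝ => 1 + x).aestronglyMeasurable.mul
      hfhm) ?_
    filter_upwards [hu_le] with x hx
    rw [Real.norm_of_nonneg hx.1]; exact hx.2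
  have hv0 : ∀ᵐ x ∂volPos, 0 ≤ v x := by
    filter_upwards [ae_volPos_pos] with x hx
    exact mul_nonneg (by linarith) (hf0 _)
  have hM0 : 0 ≤ M := integral_nonneg_of_ae hv0
  have huM : ∫ x, u x ∂volPos ≤ M :=
    (integral_mono_ae hu_int hvh (hu_le.mono fun x hx => hx.2)).trans
      (integral_shift_le hh hwf hv0)
  have h1K : BoundedKernel (fun _ _ => (1 : ℝ)) 1 :=
    ⟨measurable_const, fun _ _ => zero_le_one, fun _ _ => le_rfl⟩
  have cff := hK.integrable_collision hf hf
  have cdf := hK.integrable_collision hd_int hf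
  have cuv := h1K.integrable_collision hu_int hwf
  have hG0 := ae_integrable_gain cff
  have hGh := ae_volPos_shift hh hG0
  have hpt : ∀ᵐ x ∂volPos, |eulerStep K τ f (x + h) - eulerStep K τ f x| ≤
      d x - τ * (d x * lossRate K f x) + τ * (ω * (M * u x)) +
        τ * (gain K d f x + ω * gain (fun _ _ => 1) u v x) := by
    filter_upwards [hG0, hGh, ae_integrable_gain cdf,
      ae_integrable_gain (K := fun _ _ => 1) cuv, ae_volPos_pos] with x hx0 hxh hxd hxu hxpos
    have hloss : |lossRate K f (x + h) - lossRate K f x| ≤ ω * (1 + x) * M := by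
      have hKf : ∀ x, Integrable (fun y => K x y * f y) volPos := fun x =>
        hf.bdd_mul (c := N) (hK.measurable.of_uncurry_left).aestronglyMeasurable
          (ae_of_all _ fun y => by rw [Real.norm_of_nonneg (hK.nonneg _ _)]; exact hK.le _ _)
      unfold lossRate
      rw [← integral_sub (hKf _) (hKf _), hM, ← integral_const_mul]
      refine (abs_integral_le_integral_abs).trans (integral_mono_ae ((hKf _).sub (hKf _)).abs
        (hwf.const_mul _) ?_)
      filter_upwards [ae_volPos_pos] with y hy
      have := mul_le_mul_of_nonneg_right (hmod x hxpos y hy) (hf0 y)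
      calc |K (x + h) y * f y - K x y * f y| = |K (x + h) y - K x y| * f y := by
            rw [← sub_mul, abs_mul, abs_of_nonneg (hf0 y)]
        _ ≤ _ := by linarith
    have hgain : |gain K f f (x + h) - gain K f f x| ≤
        gain K d f x + ω * gain (fun _ _ => 1) u v x := by
      unfold gain
      rw [← integral_sub hxh hx0, ← integral_const_mul, ← integral_add hxd (hxu.const_mul ω)]
      refine (abs_integral_le_integral_abs).trans (integral_mono_ae (hxh.sub hx0).abs
        (hxd.add (hxu.const_mul ω)) ?_)
      filter_upwards [ae_volPos_pos] with y hy
      have h1 := mul_le_mul_of_nonneg_right (mul_le_mul_of_nonneg_right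
        (hmod (x + y) (by linarith) y hy) (hf0 (x + y + h))) (hf0 y)
      have h2 : x + h + y = x + y + h := by ring
      simp only [h2, hd, hu, hv]
      have h3 : K (x + y + h) y * f (x + y + h) * f y - K (x + y) y * f (x + y) * f y
          = K (x + y) y * (f (x + y + h) - f (x + y)) * f y
            + (K (x + y + h) y - K (x + y) y) * f (x + y + h) * f y := by ring
      rw [h3]
      refine (abs_add_le _ _).trans (add_le_add (le_of_eq ?_) ?_)
      · rw [abs_mul, abs_mul, abs_of_nonneg (hK.nonneg _ _), abs_of_nonneg (hf0 y)]
      · rw [abs_mul, abs_mul, abs_of_nonneg (hf0 _), abs_of_nonneg (hf0 y)]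
        linarith
    have hfac : 0 ≤ 1 - τ * lossRate K f x := by
      have := mul_le_mul_of_nonneg_left (hK.lossRate_le hf0 hf x) hτ
      linarith
    have e1 : eulerStep K τ f (x + h) - eulerStep K τ f x
        = (f (x + h) - f x) * (1 - τ * lossRate K f x)
          + (-(τ * f (x + h) * (lossRate K f (x + h) - lossRate K f x)))
          + τ * (gain K f f (x + h) - gain K f f x) := by
      simp only [eulerStep]; ring
    rw [e1]
    refine (abs_add_three _ _ _).trans ?_
    rw [abs_mul, abs_neg, abs_mul, abs_mul, abs_mul, abs_of_nonneg hfac, abs_of_nonneg hτ,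
      abs_of_nonneg (hf0 (x + h))]
    have e2 := mul_le_mul_of_nonneg_left hloss (mul_nonneg hτ (hf0 (x + h)))
    have e3 := mul_le_mul_of_nonneg_left hgain hτ
    simp only [hd, hu] at e2 e3 ⊢
    linarith
  have iL := integrable_mul_lossRate cdf
  have iG := integrable_gain cdf
  have iU := integrable_gain (K := fun _ _ => 1) cuv
  have i1 : Integrable (fun x => d x - τ * (d x * lossRate K f x)) volPos :=
    hd_int.sub (iL.const_mul τ)
  have i2 : Integrable (fun x => τ * (ω * (M * u x))) volPos :=
    ((hu_int.const_mul M).const_mul ω).const_mul τ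
  have i3 : Integrable (fun x => τ * (gain K d f x + ω * gain (fun _ _ => 1) u v x)) volPos :=
    (iG.add (iU.const_mul ω)).const_mul τ
  have i12 : Integrable (fun x => d x - τ * (d x * lossRate K f x) + τ * (ω * (M * u x)))
    volPos := i1.add i2
  refine (integral_mono_of_nonneg (ae_of_all _ fun x => abs_nonneg _) (i12.add i3)
    hpt).trans ?_
  simp only [Pi.add_apply]
  rw [integral_add i12 i3, integral_add i1 i2, integral_sub hd_int (iL.const_mul τ),
    integral_const_mul, integral_const_mul, integral_const_mul, integral_const_mul,
    integral_const_mul, integral_add iG (iU.const_mul ω), integral_const_mul,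
    integral_mul_lossRate cdf]
  have g1 := integral_gain_le cdf fun x y =>
    mul_nonneg (mul_nonneg (hK.nonneg _ _) (abs_nonneg _)) (hf0 _)
  have g2 : ∫ x, gain (fun _ _ => 1) u v x ∂volPos ≤ M * M := by
    have e1 : ∫ x, gain (fun _ _ => 1) u v x ∂volPos
        = ∫ p in largerFirst, 1 * u p.1 * v p.2 ∂(volPos.prod volPos) := by
      rw [← integral_shear (fun p => 1 * u p.1 * v p.2), integral_prod _ (integrable_shear cuv)]
      rfl
    rw [e1]
    refine (setIntegral_le_integral cuv ?_).trans ?_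
    · filter_upwards [ae_prod_volPos_pos] with p hp
      have : 0 ≤ u p.1 := mul_nonneg (by linarith [hp.1]) (hf0 _)
      have : 0 ≤ v p.2 := mul_nonneg (by linarith [hp.2]) (hf0 _)
      simp only [Pi.zero_apply]
      positivity
    · simp only [one_mul]
      rw [integral_prod_mul]
      exact mul_le_mul_of_nonneg_right huM hM0
  have g3 := mul_le_mul_of_nonneg_left huM hM0
  have g4 := mul_le_mul_of_nonneg_left g3 hω
  have g5 := mul_le_mul_of_nonneg_left g2 hω
  have g6 := mul_le_mul_of_nonneg_left (add_le_add (add_le_add g1 g4) g5) hτ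
  nlinarith [g6]

/-- An Euler step moves the density by `O(τ)` in `L¹`. -/
theorem eulerStep_dist_le {K : ℝ → ℝ → ℝ} {N τ C : ℝ} {f : ℝ → ℝ} (hK : BoundedKernel K N)
    (hτ : 0 ≤ τ) (hf0 : ∀ x, 0 ≤ f x)
    (hf : Integrable f volPos) (hwf : Integrable (fun x => (1 + x) * f x) volPos)
    (hKC : ∀ x > 0, ∀ y > 0, K x y ≤ C * ((1 + x) * (1 + y))) :
    ∫ x, |eulerStep K τ f x - f x| ∂volPos ≤
      2 * τ * C * (∫ x, (1 + x) * f x ∂volPos) ^ 2 := by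
  have cff := hK.integrable_collision hf hf
  have iL := integrable_mul_lossRate cff
  have iG := integrable_gain cff
  have hpt : ∀ x, |eulerStep K τ f x - f x| ≤ τ * (f x * lossRate K f x + gain K f f x) := by
    intro x
    have h1 := mul_nonneg hτ (mul_nonneg (hf0 x) (lossRate_nonneg hK.nonneg hf0 x))
    have h2 := mul_nonneg hτ (gain_nonneg hK.nonneg hf0 hf0 x)
    simp only [eulerStep]
    rw [abs_le]
    constructor <;> nlinarith
  refine (integral_mono_of_nonneg (ae_of_all _ fun x => abs_nonneg _)
    ((iL.add iG).const_mul τ) (ae_of_all _ hpt)).trans ?_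
  rw [integral_const_mul]
  simp only [Pi.add_apply]
  rw [integral_add iL iG, integral_mul_lossRate cff]
  have g1 := integral_gain_le cff fun x y =>
    mul_nonneg (mul_nonneg (hK.nonneg _ _) (hf0 _)) (hf0 _)
  have g2 : ∫ p, K p.1 p.2 * f p.1 * f p.2 ∂(volPos.prod volPos)
      ≤ C * (∫ x, (1 + x) * f x ∂volPos) ^ 2 := by
    rw [sq, ← integral_prod_mul, ← integral_const_mul]
    refine integral_mono_ae cff ((hwf.mul_prod hwf).const_mul C) ?_
    filter_upwards [ae_prod_volPos_pos] with p hp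
    have := mul_le_mul_of_nonneg_right (mul_le_mul_of_nonneg_right
        (hKC p.1 hp.1 p.2 hp.2) (hf0 p.1)) (hf0 p.2)
    linarith
  nlinarith [mul_le_mul_of_nonneg_left g2 hτ, mul_le_mul_of_nonneg_left g1 hτ]

/-! ### Compactness in `L¹(0, ∞)` -/

theorem dist_L1Pos_eq (g₁ g₂ : L1Pos) : dist g₁ g₂ = ∫ x, |g₁ x - g₂ x| ∂volPos := by
  simpa only [Real.dist_eq] using L1.dist_eq_integral_dist g₁ g₂

/-- The `L¹` norm on `(0, R]` is controlled by averages over the cells of a mesh and by the `L¹`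
translation defect. Each `u x` is compared with the average over the cell to the right of the one
containing `x`, so that only translations to the right occur. -/
theorem setIntegral_abs_le_of_cells {u : ℝ → ℝ} (hu : Integrable u volPos) {h R η D : ℝ}
    (hh : 0 < h) (hR : 0 ≤ R)
    (hη : ∀ j : ℕ, j * h ≤ R → |∫ x in Ioc ((j + 1) * h) ((j + 2) * h), u x| ≤ η)
    (hD : ∀ k, 0 < k → k ≤ 2 * h → ∫ x, |u (x + k) - u x| ∂volPos ≤ D) :
    ∫ x in Ioc 0 R, |u x| ≤ R * η / h + 2 * D := by
  set χ : ℝ → ℝ := (Ioc 0 (2 * h)).indicator 1 with hχ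
  have hχ_int : Integrable χ volPos :=
    ((integrable_indicator_iff measurableSet_Ioc).2
      (integrableOn_const measure_Ioc_lt_top.ne)).restrict
  have hχ0 : ∀ k, 0 ≤ χ k := fun k => indicator_nonneg (fun _ _ => zero_le_one) k
  have hW : Integrable (fun p : ℝ × ℝ => |u (p.1 + p.2) - u p.1| * χ p.2)
      (volPos.prod volPos) := by
    have h1 := integrable_shear (hu.mul_prod hχ_int)
    have h2 := hu.mul_prod hχ_int
    refine (h1.sub h2).abs.congr (ae_of_all _ fun p => ?_)
    simp only [Pi.sub_apply]
    rw [← sub_mul, abs_mul, abs_of_nonneg (hχ0 _)]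
  have huI : ∀ a b : ℝ, 0 ≤ a → IntegrableOn u (Ioc a b) := fun a b ha =>
    IntegrableOn.mono_set (show IntegrableOn u (Ioi 0) volume from hu)
      fun x hx => mem_Ioi.2 (ha.trans_lt hx.1)
  have hpt : ∀ᵐ x ∂volPos, x ≤ R →
      |u x| ≤ (η + ∫ k, |u (x + k) - u x| * χ k ∂volPos) / h := by
    filter_upwards [hW.prod_right_ae, ae_volPos_pos] with x hx hx0 hxR
    rw [le_div_iff₀ hh]
    set j : ℕ := ⌊x / h⌋₊ with hj
    have hj1 : j * h ≤ x := (le_div_iff₀ hh).1 (Nat.floor_le (by positivity))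
    have hj2 : x < (j + 1) * h := (div_lt_iff₀ hh).1 (Nat.lt_floor_add_one _)
    set I := Ioc (((j : ℝ) + 1) * h) ((j + 2) * h) with hI
    have hvol : volume.real I = h := by
      rw [hI, Real.volume_real_Ioc_of_le (by nlinarith)]; ring
    have hIint : IntegrableOn u I := huI _ _ (by positivity)
    have hcI : IntegrableOn (fun _ : ℝ => u x) I := by simp [hI]
    have e1 : ∫ y in I, (u x - u y) = u x * h - ∫ y in I, u y := by
      rw [integral_sub hcI hIint, setIntegral_const, hvol, smul_eq_mul, mul_comm]
    have e2 : |∫ y in I, (u x - u y)| ≤ ∫ k, |u (x + k) - u x| * χ k ∂volPos := by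
      refine abs_integral_le_integral_abs.trans ?_
      rw [← integral_indicator measurableSet_Ioc,
        ← integral_add_left_eq_self _ x]
      unfold volPos
      rw [← integral_indicator measurableSet_Ioi]
      refine integral_mono_of_nonneg (ae_of_all _ fun k => indicator_nonneg
        (fun _ _ => abs_nonneg _) _) ((integrable_indicator_iff measurableSet_Ioi).2 hx)
        (ae_of_all _ fun k => ?_)
      simp only
      by_cases hk : x + k ∈ I
      · have hk0 : 0 < k := by linarith [hk.1]
        have hk2 : k ≤ 2 * h := by have := hk.2; nlinarith
        rw [indicator_of_mem hk, indicator_of_mem (mem_Ioi.2 hk0), hχ,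
          indicator_of_mem (show k ∈ Ioc 0 (2 * h) from ⟨hk0, hk2⟩), Pi.one_apply, mul_one,
          abs_sub_comm]
      · rw [indicator_of_notMem hk]
        exact indicator_nonneg (fun _ _ => mul_nonneg (abs_nonneg _) (hχ0 _)) _
    have e3 := hη j (hj1.trans hxR)
    have e4 : |u x| * h = |u x * h| := by rw [abs_mul, abs_of_pos hh]
    rw [e4]
    have e5 : u x * h = (∫ y in I, u y) + ∫ y in I, (u x - u y) := by rw [e1]; ring
    rw [e5]
    exact (abs_add_le _ _).trans (add_le_add e3 e2)
  have hWx := hW.integral_prod_left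
  have hsub : volume.restrict (Ioc 0 R) ≤ volPos :=
    Measure.restrict_mono Ioc_subset_Ioi_self le_rfl
  have hcR : IntegrableOn (fun _ : ℝ => η) (Ioc 0 R) := by simp
  have step1 : ∫ x in Ioc 0 R, |u x|
      ≤ ∫ x in Ioc 0 R, (η + ∫ k, |u (x + k) - u x| * χ k ∂volPos) / h := by
    refine integral_mono_of_nonneg (ae_of_all _ fun _ => abs_nonneg _)
      ((hcR.add (hWx.mono_measure hsub)).div_const h) ?_
    filter_upwards [ae_mono hsub hpt, ae_restrict_mem measurableSet_Ioc] with x hx hxR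
    exact hx hxR.2
  refine step1.trans ?_
  rw [integral_div, integral_add hcR (hWx.mono_measure hsub), setIntegral_const,
    Real.volume_real_Ioc_of_le hR, smul_eq_mul, sub_zero]
  have step2 : ∫ x in Ioc 0 R, ∫ k, |u (x + k) - u x| * χ k ∂volPos ≤ 2 * h * D := by
    refine (integral_mono_measure hsub (ae_of_all _ fun x => integral_nonneg fun k =>
      mul_nonneg (abs_nonneg _) (hχ0 _)) hWx).trans ?_
    rw [integral_integral_swap hW]
    have h3 : ∫ k, D * χ k ∂volPos = 2 * h * D := by
      rw [integral_const_mul, hχ]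
      unfold volPos
      rw [setIntegral_indicator measurableSet_Ioc,
        inter_eq_self_of_subset_right Ioc_subset_Ioi_self]
      simp [hh.le, mul_comm]
    rw [← h3]
    refine integral_mono_of_nonneg (ae_of_all _ fun k => integral_nonneg fun x =>
      mul_nonneg (abs_nonneg _) (hχ0 _)) (hχ_int.const_mul D) (ae_of_all _ fun k => ?_)
    simp only
    rw [integral_mul_const]
    by_cases hk : k ∈ Ioc 0 (2 * h)
    · exact mul_le_mul_of_nonneg_right (hD k hk.1 hk.2) (hχ0 _)
    · simp [hχ, indicator_of_notMem hk]
  calc (R * η + ∫ x in Ioc 0 R, ∫ k, |u (x + k) - u x| * χ k ∂volPos) / h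
      ≤ (R * η + 2 * h * D) / h := by gcongr
    _ = _ := by field_simp

/-- A form of the Kolmogorov–Riesz criterion on `(0, ∞)`: a set bounded in the weighted norm whose
translations to the right converge uniformly is totally bounded in `L¹`. -/
theorem totallyBounded_of_shift {S : Set L1Pos} {M : ℝ}
    (hint : ∀ g ∈ S, Integrable (fun x => (1 + x) * |g x|) volPos)
    (hM : ∀ g ∈ S, ∫ x, (1 + x) * |g x| ∂volPos ≤ M)
    (hshift : ∀ ε > 0, ∃ δ > 0, ∀ g ∈ S, ∀ k, 0 < k → k < δ →
      ∫ x, |g (x + k) - g x| ∂volPos ≤ ε) :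
    TotallyBounded S := by
  rcases S.eq_empty_or_nonempty with rfl | ⟨g₀, hg₀⟩
  · exact totallyBounded_empty
  have hw0 : ∀ g : L1Pos, ∀ᵐ x ∂volPos, 0 ≤ (1 + x) * |g x| := fun g => by
    filter_upwards [ae_volPos_pos] with x hx
    exact mul_nonneg (by linarith) (abs_nonneg _)
  have hM0 : 0 ≤ M := (integral_nonneg_of_ae (hw0 g₀)).trans (hM g₀ hg₀)
  refine Metric.totallyBounded_of_finite_discretization fun ε hε => ?_
  obtain ⟨δ, hδ, hs⟩ := hshift (ε / 16) (by positivity)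
  set h := δ / 3 with hh_def
  have hh : 0 < h := by positivity
  set R := 8 * M / ε + 1 with hR_def
  have hR : 0 < R := by positivity
  set η := ε * h / (4 * R) with hη_def
  have hη : 0 < η := by positivity
  set N := ⌈R / h⌉₊ + 1 with hN
  set B : ℤ := ⌈M / η⌉ + 1 with hB
  let a : ℕ → L1Pos → ℝ := fun j g => ∫ x in Ioc (((j : ℝ) + 1) * h) ((j + 2) * h), g x
  have hI : ∀ j : ℕ, Ioc (((j : ℝ) + 1) * h) ((j + 2) * h) ⊆ Ioi 0 := fun j x hx =>
    mem_Ioi.2 (lt_of_le_of_lt (by positivity) hx.1)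
  have hgint : ∀ g : L1Pos, Integrable g volPos := fun g => L1.integrable_coeFn g
  have ha : ∀ j, ∀ g ∈ S, |a j g| ≤ M := by
    intro j g hg
    refine abs_integral_le_integral_abs.trans ((integral_mono_measure
      (Measure.restrict_mono (hI j) le_rfl) (ae_of_all _ fun _ => abs_nonneg _)
      (show Integrable (fun x => |g x|) volPos from (hgint g).abs)).trans
      (le_trans ?_ (hM g hg)))
    refine integral_mono_ae (hgint g).abs (hint g hg) ?_
    filter_upwards [ae_volPos_pos] with x hx
    exact le_mul_of_one_le_left (abs_nonneg _) (by linarith)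
  have hfl : ∀ j, ∀ g ∈ S, ⌊a j g / η⌋ ∈ Finset.Icc (-B) B := by
    intro j g hg
    have h1 := abs_le.1 (ha j g hg)
    have h2 : M / η ≤ ⌈M / η⌉ := Int.le_ceil _
    have h3 : a j g / η ≤ M / η := by gcongr; exact h1.2
    have h4 : -(M / η) ≤ a j g / η := by
      rw [← neg_div]; gcongr; exact h1.1
    rw [Finset.mem_Icc]
    constructor
    · rw [Int.le_floor, hB]; push_cast; linarith
    · rw [hB]
      have : (⌊a j g / η⌋ : ℝ) ≤ ⌈M / η⌉ := (Int.floor_le _).trans (h3.trans h2)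
      have : ⌊a j g / η⌋ ≤ ⌈M / η⌉ := by exact_mod_cast this
      linarith
  refine ⟨Fin N → Finset.Icc (-B) B, inferInstance,
    fun g j => ⟨⌊a j g / η⌋, hfl j g g.2⟩, fun g₁ g₂ hg => ?_⟩
  obtain ⟨g₁, hg₁⟩ := g₁
  obtain ⟨g₂, hg₂⟩ := g₂
  simp only at hg ⊢
  rw [dist_L1Pos_eq]
  set u : ℝ → ℝ := fun x => g₁ x - g₂ x with hu
  have hu_int : Integrable u volPos := (hgint g₁).sub (hgint g₂)
  have hcell : ∀ j : ℕ, j * h ≤ R →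
      |∫ x in Ioc (((j : ℝ) + 1) * h) ((j + 2) * h), u x| ≤ η := by
    intro j hj
    have hjN : j < N := by
      have : (j : ℝ) ≤ R / h := (le_div_iff₀ hh).2 hj
      have : (j : ℝ) ≤ ⌈R / h⌉₊ := this.trans (Nat.le_ceil _)
      have : j ≤ ⌈R / h⌉₊ := by exact_mod_cast this
      omega
    have h1 := congrArg Subtype.val (congrFun hg ⟨j, hjN⟩)
    simp only at h1
    have h2 := Int.abs_sub_lt_one_of_floor_eq_floor h1
    rw [← sub_div, abs_div, abs_of_pos hη, div_lt_one hη] at h2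
    have h3 : ∫ x in Ioc (((j : ℝ) + 1) * h) ((j + 2) * h), u x = a j g₁ - a j g₂ :=
      integral_sub
        (IntegrableOn.mono_set (show IntegrableOn g₁ (Ioi 0) volume from hgint g₁) (hI j))
        (IntegrableOn.mono_set (show IntegrableOn g₂ (Ioi 0) volume from hgint g₂) (hI j))
    rw [h3]
    exact h2.le
  have hD : ∀ k, 0 < k → k ≤ 2 * h → ∫ x, |u (x + k) - u x| ∂volPos ≤ ε / 8 := by
    intro k hk0 hk
    have hkδ : k < δ := by rw [hh_def] at hk; linarith
    have i1 := ((integrable_shift hk0.le (hgint g₁)).sub (hgint g₁)).abs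
    have i2 := ((integrable_shift hk0.le (hgint g₂)).sub (hgint g₂)).abs
    have h1 := hs g₁ hg₁ k hk0 hkδ
    have h2 := hs g₂ hg₂ k hk0 hkδ
    have h3 : ∫ x, |u (x + k) - u x| ∂volPos
        ≤ ∫ x, (|g₁ (x + k) - g₁ x| + |g₂ (x + k) - g₂ x|) ∂volPos := by
      refine integral_mono_of_nonneg (ae_of_all _ fun _ => abs_nonneg _) (i1.add i2)
        (ae_of_all _ fun x => ?_)
      simp only [hu]
      rw [show g₁ (x + k) - g₂ (x + k) - (g₁ x - g₂ x)
        = (g₁ (x + k) - g₁ x) - (g₂ (x + k) - g₂ x) by ring]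
      exact abs_sub _ _
    have h4 := integral_add i1 i2
    simp only [Pi.sub_apply] at h4
    rw [h4] at h3
    linarith
  have hbulk := setIntegral_abs_le_of_cells hu_int hh hR.le hcell hD
  have htail : ∫ x in Ioi R, |u x| ≤ 2 * M / R := by
    rw [le_div_iff₀ hR, ← integral_mul_const]
    have i1 := hint g₁ hg₁
    have i2 := hint g₂ hg₂
    have hsub : volume.restrict (Ioi R) ≤ volPos :=
      Measure.restrict_mono (Ioi_subset_Ioi hR.le) le_rfl
    calc ∫ x in Ioi R, |u x| * R
        ≤ ∫ x in Ioi R, ((1 + x) * |g₁ x| + (1 + x) * |g₂ x|) := by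
          refine integral_mono_of_nonneg (ae_of_all _ fun x => mul_nonneg (abs_nonneg _) hR.le)
            ((i1.add i2).mono_measure hsub) ?_
          filter_upwards [ae_restrict_mem measurableSet_Ioi] with x hx
          have hx' : R < x := hx
          have h1 : |u x| ≤ |g₁ x| + |g₂ x| := abs_sub _ _
          have h2 := abs_nonneg (g₁ x)
          have h3 := abs_nonneg (g₂ x)
          nlinarith
      _ ≤ ∫ x, ((1 + x) * |g₁ x| + (1 + x) * |g₂ x|) ∂volPos := by
          refine integral_mono_measure hsub ?_ (i1.add i2)
          filter_upwards [hw0 g₁, hw0 g₂] with x h1 h2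
          exact add_nonneg h1 h2
      _ ≤ 2 * M := by
          rw [integral_add i1 i2]
          linarith [hM g₁ hg₁, hM g₂ hg₂]
  have hsplit : ∫ x, |u x| ∂volPos = (∫ x in Ioc 0 R, |u x|) + ∫ x in Ioi R, |u x| := by
    unfold volPos
    rw [← Ioc_union_Ioi_eq_Ioi hR.le]
    have hab : IntegrableOn (fun x => |u x|) (Ioi 0) := hu_int.abs
    exact setIntegral_union (Ioc_disjoint_Ioi le_rfl) measurableSet_Ioi
      (hab.mono_set Ioc_subset_Ioi_self) (hab.mono_set (Ioi_subset_Ioi hR.le))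
  rw [hsplit]
  have e1 : R * η / h = ε / 4 := by rw [hη_def]; field_simp
  have e2 : 2 * M / R ≤ ε / 4 := by
    rw [div_le_iff₀ hR, hR_def]
    have : ε / 4 * (8 * M / ε + 1) = 2 * M + ε / 4 := by field_simp; ring
    linarith
  linarith

/-! ### Limits and representatives of curves in `L¹(0, ∞)` -/

/-- Diagonal extraction for maps that are equicontinuous in time up to an error `τ n → 0`: a single
subsequence converges at all times. -/
theorem exists_subseq_tendsto_of_totallyBounded {E : Type*} [MetricSpace E] [CompleteSpace E]
    {F : ℕ → ℝ → E} {L : ℝ} {τ : ℕ → ℝ} (hτ : Tendsto τ atTop (𝓝 0)) (hL : 0 ≤ L)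
    (htb : ∀ t, 0 ≤ t → TotallyBounded (range fun n => F n t))
    (heq : ∀ n s t, 0 ≤ s → 0 ≤ t → dist (F n s) (F n t) ≤ L * (|s - t| + τ n)) :
    ∃ φ : ℕ → ℕ, StrictMono φ ∧ ∃ G : ℝ → E,
      ∀ t, 0 ≤ t → Tendsto (fun n => F (φ n) t) atTop (𝓝 (G t)) := by
  have hcpt : IsCompact (Set.pi univ fun q : ℚ≥0 => closure (range fun n => F n (q : ℝ))) :=
    isCompact_univ_pi fun q =>
      isCompact_iff_totallyBounded_isComplete.2
        ⟨(htb q (by positivity)).closure, isClosed_closure.isComplete⟩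
  obtain ⟨g, -, φ, hφ, hg⟩ := hcpt.isSeqCompact (x := fun n (q : ℚ≥0) => F n (q : ℝ))
    fun n q _ => subset_closure ⟨n, rfl⟩
  rw [tendsto_pi_nhds] at hg
  have hc : ∀ t, 0 ≤ t → ∃ a, Tendsto (fun n => F (φ n) t) atTop (𝓝 a) := by
    intro t ht
    refine cauchySeq_tendsto_of_complete (Metric.cauchySeq_iff.2 fun ε hε => ?_)
    obtain ⟨q, hq1, hq2⟩ := exists_rat_btwn (show t < t + ε / (8 * (L + 1)) by
      have : 0 < ε / (8 * (L + 1)) := by positivity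
      linarith)
    have hq0 : 0 ≤ q := by
      have : (0 : ℝ) ≤ q := ht.trans hq1.le
      exact_mod_cast this
    lift q to ℚ≥0 using hq0
    have hq3 : |t - ((q : ℚ) : ℝ)| ≤ ε / (8 * (L + 1)) := by
      rw [abs_le]; constructor <;> linarith
    obtain ⟨N₁, hN₁⟩ := eventually_atTop.1 ((hτ.comp hφ.tendsto_atTop).eventually
      (gt_mem_nhds (show (0 : ℝ) < ε / (8 * (L + 1)) by positivity)))
    obtain ⟨N₂, hN₂⟩ := Metric.cauchySeq_iff.1 (hg q).cauchySeq (ε / 4) (by positivity)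
    have key : ∀ n ≥ N₁, dist (F (φ n) t) (F (φ n) ((q : ℚ) : ℝ)) ≤ ε / 4 := by
      intro n hn
      have h1 := hN₁ n hn
      simp only [Function.comp] at h1
      have h2 := heq (φ n) t ((q : ℚ) : ℝ) ht (ht.trans hq1.le)
      have h3 : L * (|t - ((q : ℚ) : ℝ)| + τ (φ n))
          ≤ (L + 1) * (ε / (8 * (L + 1)) + ε / (8 * (L + 1))) := by
        have h4 : |t - ((q : ℚ) : ℝ)| + τ (φ n) ≤ ε / (8 * (L + 1)) + ε / (8 * (L + 1)) := by
          linarith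
        have h5 : 0 ≤ ε / (8 * (L + 1)) + ε / (8 * (L + 1)) := by positivity
        nlinarith
      have h6 : (L + 1) * (ε / (8 * (L + 1)) + ε / (8 * (L + 1))) = ε / 4 := by
        field_simp; ring
      linarith
    refine ⟨max N₁ N₂, fun m hm n hn => ?_⟩
    have h1 := key m ((le_max_left _ _).trans hm)
    have h2 := key n ((le_max_left _ _).trans hn)
    have h3 := hN₂ m ((le_max_right _ _).trans hm) n ((le_max_right _ _).trans hn)
    simp only [Function.comp] at h3
    have h4 := dist_triangle4 (F (φ m) t) (F (φ m) ((q : ℚ) : ℝ)) (F (φ n) ((q : ℚ) : ℝ))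
      (F (φ n) t)
    rw [dist_comm (F (φ n) ((q : ℚ) : ℝ)) (F (φ n) t)] at h4
    have h5 : dist (F (φ m) ((q : ℚ) : ℝ)) (F (φ n) ((q : ℚ) : ℝ)) < ε / 4 := h3
    linarith
  have : Nonempty E := ⟨F 0 0⟩
  choose! G hG using hc
  exact ⟨φ, hφ, G, hG⟩

/-- Weighted moments are lower semicontinuous along `L¹`-convergent sequences of non-negative
densities. -/
theorem moment_le_of_tendsto {φ : ℝ → ℝ} (hφm : Measurable φ) (hφ0 : ∀ x, 0 < x → 0 ≤ φ x)
    {G : ℕ → L1Pos} {g : L1Pos} (hG : Tendsto G atTop (𝓝 g)) {c : ℝ}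
    (h0 : ∀ n, ∀ᵐ x ∂volPos, 0 ≤ G n x) (hint : ∀ n, Integrable (fun x => φ x * G n x) volPos)
    (hc : ∀ n, ∫ x, φ x * G n x ∂volPos ≤ c) :
    (∀ᵐ x ∂volPos, 0 ≤ g x) ∧ Integrable (fun x => φ x * g x) volPos ∧
      ∫ x, φ x * g x ∂volPos ≤ c := by
  obtain ⟨ns, -, hns⟩ := (tendstoInMeasure_of_tendsto_Lp hG).exists_seq_tendsto_ae
  have hg0 : ∀ᵐ x ∂volPos, 0 ≤ g x := by
    filter_upwards [hns, ae_all_iff.2 h0] with x hx hx0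
    exact ge_of_tendsto' hx fun n => hx0 _
  have hφg0 : ∀ᵐ x ∂volPos, 0 ≤ φ x * g x := by
    filter_upwards [hg0, ae_volPos_pos] with x hx hx0 using mul_nonneg (hφ0 x hx0) hx
  have hφG0 : ∀ n, ∀ᵐ x ∂volPos, 0 ≤ φ x * G n x := fun n => by
    filter_upwards [h0 n, ae_volPos_pos] with x hx hx0 using mul_nonneg (hφ0 x hx0) hx
  have hc0 : 0 ≤ c := (integral_nonneg_of_ae (hφG0 0)).trans (hc 0)
  have hle : ∫⁻ x, ENNReal.ofReal (φ x * g x) ∂volPos ≤ ENNReal.ofReal c := by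
    have h1 : ∫⁻ x, ENNReal.ofReal (φ x * g x) ∂volPos
        ≤ ∫⁻ x, liminf (fun n => ENNReal.ofReal (φ x * G (ns n) x)) atTop ∂volPos := by
      refine lintegral_mono_ae ?_
      filter_upwards [hns] with x hx
      have : Tendsto (fun n => ENNReal.ofReal (φ x * G (ns n) x)) atTop
          (𝓝 (ENNReal.ofReal (φ x * g x))) := ENNReal.tendsto_ofReal (hx.const_mul _)
      exact this.liminf_eq.ge
    refine h1.trans ((lintegral_liminf_le' fun n => (hφm.aemeasurable.mul
      (Lp.aestronglyMeasurable _).aemeasurable).ennreal_ofReal).trans ?_)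
    refine liminf_le_of_le (by isBoundedDefault) fun b hb => ?_
    obtain ⟨n, hn⟩ := hb.exists
    refine hn.trans ?_
    have h2 := ofReal_integral_eq_lintegral_ofReal (hint (ns n)) (hφG0 (ns n))
    simp only [Pi.mul_apply]
    rw [← h2]
    exact ENNReal.ofReal_le_ofReal (hc _)
  have hm : AEStronglyMeasurable (fun x => φ x * g x) volPos :=
    hφm.aestronglyMeasurable.mul (Lp.aestronglyMeasurable g)
  have hint' : Integrable (fun x => φ x * g x) volPos :=
    (lintegral_ofReal_ne_top_iff_integrable hm hφg0).1 (hle.trans_lt ENNReal.ofReal_lt_top).ne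
  refine ⟨hg0, hint', ?_⟩
  rw [integral_eq_lintegral_of_nonneg_ae hφg0 hm]
  exact ENNReal.toReal_le_of_le_ofReal hc0 hle

/-- A continuous curve of non-negative elements of `L¹` has a jointly measurable representative,
namely the upper limit of its averages over `(x, x + 1 / (n + 1)]`: these are jointly measurable,
and by Lebesgue's differentiation theorem they converge at almost every `x` for every time. -/
theorem exists_measurable_representative {F : ℝ → L1Pos} (hF : Continuous F)
    (h0 : ∀ t, ∀ᵐ x ∂volPos, 0 ≤ F t x) :
    ∃ f : ℝ → ℝ → ℝ, Measurable (Function.uncurry f) ∧ (∀ t x, 0 ≤ f t x) ∧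
      ∀ t, f t =ᵐ[volPos] F t := by
  let e : ℝ → ℝ → ℝ := fun t => (Ioi (0 : ℝ)).indicator (F t)
  have he : ∀ t, Integrable (e t) := fun t =>
    (integrable_indicator_iff measurableSet_Ioi).2 (L1.integrable_coeFn (F t))
  let a : ℕ → ℝ → ℝ → ℝ := fun n t x =>
    ((1 : ℝ) / (n + 1))⁻¹ *
      ((∫ y in (0 : ℝ)..(x + 1 / (n + 1)), e t y) - ∫ y in (0 : ℝ)..x, e t y)
  have hprim : Measurable (Function.uncurry fun t x => ∫ y in (0 : ℝ)..x, e t y) := by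
    refine (stronglyMeasurable_uncurry_of_continuous_of_stronglyMeasurable
      (u := fun t x => ∫ y in (0 : ℝ)..x, e t y) (fun x => ?_) (fun t => ?_)).measurable
    · refine Metric.continuous_iff.2 fun s ε hε => ?_
      obtain ⟨δ, hδ, hd⟩ := Metric.continuous_iff.1 hF s ε hε
      refine ⟨δ, hδ, fun t ht => lt_of_le_of_lt ?_ (hd t ht)⟩
      rw [Real.dist_eq, ← intervalIntegral.integral_sub (he t).intervalIntegrable
        (he s).intervalIntegrable, dist_L1Pos_eq]
      refine (intervalIntegral.norm_integral_le_integral_norm_uIoc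
        (f := fun y => e t y - e s y) (μ := volume)).trans ?_
      refine (setIntegral_le_integral ((he t).sub (he s)).norm
        (ae_of_all _ fun _ => norm_nonneg _)).trans (le_of_eq ?_)
      unfold volPos
      rw [← integral_indicator measurableSet_Ioi]
      congr 1
      ext y
      by_cases hy : y ∈ Ioi (0 : ℝ)
      · simp only [e, Pi.sub_apply, indicator_of_mem hy]
        rfl
      · simp only [e, Pi.sub_apply, indicator_of_notMem hy, sub_zero, norm_zero]
    · exact (intervalIntegral.continuous_primitive
        (fun _ _ => (he t).intervalIntegrable) 0).stronglyMeasurable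
  have ha : ∀ n, Measurable (Function.uncurry (a n)) := by
    intro n
    have h1 : Measurable fun p : ℝ × ℝ => (p.1, p.2 + 1 / ((n : ℝ) + 1)) := by fun_prop
    exact ((hprim.comp h1).sub hprim).const_mul (((1 : ℝ) / (n + 1))⁻¹)
  refine ⟨fun t x => (limsup (fun n => ENNReal.ofReal (a n t x)) atTop).toReal, ?_,
    fun _ _ => ENNReal.toReal_nonneg, fun t => ?_⟩
  · have : Measurable fun p : ℝ × ℝ => limsup (fun n => ENNReal.ofReal (a n p.1 p.2)) atTop :=
      Measurable.limsup fun n => (ha n).ennreal_ofReal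
    exact this.ennreal_toReal
  · have hseq : Tendsto (fun n : ℕ => (1 : ℝ) / (n + 1)) atTop (𝓝[≠] 0) :=
      tendsto_nhdsWithin_iff.2 ⟨tendsto_one_div_add_atTop_nhds_zero_nat,
        Eventually.of_forall fun n => by
          have : (0 : ℝ) < 1 / (n + 1) := by positivity
          exact this.ne'⟩
    filter_upwards [ae_restrict_of_ae (LocallyIntegrable.ae_hasDerivAt_integral
      (he t).locallyIntegrable),
      ae_volPos_pos, h0 t] with x hx hx0 hxF
    have h1 := (hasDerivAt_iff_tendsto_slope_zero.1 (hx 0)).comp hseq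
    have h2 : e t x = F t x := indicator_of_mem (mem_Ioi.2 hx0) _
    rw [h2] at h1
    have h3 := (ENNReal.tendsto_ofReal h1).limsup_eq
    have h4 : limsup (fun n => ENNReal.ofReal (a n t x)) atTop = ENNReal.ofReal (F t x) := h3
    rw [h4, ENNReal.toReal_ofReal hxF]

/-- Continuity of translations in `L¹`, for translations of the half-line to the right. -/
theorem exists_shift_integral_le {u : ℝ → ℝ} (hu : Integrable u volPos) {ε : ℝ} (hε : 0 < ε) :
    ∃ δ > 0, ∀ h, 0 < h → h < δ → ∫ x, |u (x + h) - u x| ∂volPos ≤ ε := by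
  set e : ℝ → ℝ := (Ioi (0 : ℝ)).indicator u with he
  have hei : Integrable e := (integrable_indicator_iff measurableSet_Ioi).2 hu
  have hmp : ∀ h : ℝ, MeasurePreserving (fun x : ℝ => x + h) volume volume :=
    fun h => measurePreserving_add_right volume h
  let g : ℝ → C(ℝ, ℝ) := fun h => ⟨fun x => x + h, by fun_prop⟩
  have hg : Continuous g := by
    refine ContinuousMap.continuous_of_continuous_uncurry _ ?_
    simp only [g, Function.uncurry_def, ContinuousMap.coe_mk]
    fun_prop
  let E : Lp ℝ 1 (volume : Measure ℝ) := hei.toL1 e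
  have hc : Continuous fun h => Lp.compMeasurePreserving (g h) (hmp h) E :=
    continuous_const.compMeasurePreservingLp hg hmp ENNReal.one_ne_top
  obtain ⟨δ, hδ, hd⟩ := Metric.continuous_iff.1 hc 0 ε hε
  refine ⟨δ, hδ, fun h h0 h1 => ?_⟩
  have h2 := hd h (by rwa [Real.dist_eq, sub_zero, abs_of_pos h0])
  rw [L1.dist_eq_integral_dist] at h2
  have hE : E =ᵐ[volume] e := hei.coeFn_toL1
  have h3 : ∫ x, dist ((Lp.compMeasurePreserving (g h) (hmp h) E) x)
      ((Lp.compMeasurePreserving (g 0) (hmp 0) E) x) = ∫ x, |e (x + h) - e x| := by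
    refine integral_congr_ae ?_
    filter_upwards [Lp.coeFn_compMeasurePreserving E (hmp h),
      Lp.coeFn_compMeasurePreserving E (hmp 0), hE,
      (hmp h).quasiMeasurePreserving.ae hE] with x hx1 hx2 hx3 hx4
    have e1 : (Lp.compMeasurePreserving (g h) (hmp h) E) x = e (x + h) := hx1.trans hx4
    have e2 : (Lp.compMeasurePreserving (g 0) (hmp 0) E) x = e x := by
      refine hx2.trans ?_
      simp only [Function.comp, add_zero]
      exact hx3
    rw [e1, e2, Real.dist_eq]
  rw [h3] at h2
  refine le_trans ?_ h2.le
  have h4 : ∫ x, |u (x + h) - u x| ∂volPos = ∫ x in Ioi 0, |e (x + h) - e x| := by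
    refine setIntegral_congr_fun measurableSet_Ioi fun x hx => ?_
    have hx' : (0 : ℝ) < x := hx
    simp only [he, indicator_of_mem hx, indicator_of_mem (mem_Ioi.2 (add_pos hx' h0))]
  rw [h4]
  exact setIntegral_le_integral (((hmp h).integrable_comp_of_integrable hei).sub hei).abs
    (ae_of_all _ fun _ => abs_nonneg _)

/-! ### Bounded densities and the weak collision rate -/

/-- The bounds propagated by the scheme: a non-negative density whose weighted mass is at most `M`
and whose first moment is at most `m`. -/
structure BoundedDensity (M m : ℝ) (u : ℝ → ℝ) : Prop where
  measurable : Measurable u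
  nonneg : ∀ x, 0 ≤ u x
  integrable_weight : Integrable (fun x => (1 + x) * u x) volPos
  weight_le : ∫ x, (1 + x) * u x ∂volPos ≤ M
  moment_le : ∫ x, x * u x ∂volPos ≤ m

namespace BoundedDensity

variable {M m : ℝ} {u : ℝ → ℝ}

theorem weight_nonneg (hu : BoundedDensity M m u) : ∀ᵐ x ∂volPos, 0 ≤ (1 + x) * u x := by
  filter_upwards [ae_volPos_pos] with x hx using mul_nonneg (by linarith) (hu.nonneg x)

theorem bound_nonneg (hu : BoundedDensity M m u) : 0 ≤ M :=
  (integral_nonneg_of_ae hu.weight_nonneg).trans hu.weight_le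

theorem integrable (hu : BoundedDensity M m u) : Integrable u volPos := by
  refine hu.integrable_weight.mono' hu.measurable.aestronglyMeasurable ?_
  filter_upwards [ae_volPos_pos] with x hx
  rw [Real.norm_of_nonneg (hu.nonneg x)]
  exact le_mul_of_one_le_left (hu.nonneg x) (by linarith)

theorem integrable_moment (hu : BoundedDensity M m u) :
    Integrable (fun x => x * u x) volPos :=
  (hu.integrable_weight.sub hu.integrable).congr (ae_of_all _ fun x => by
    simp only [Pi.sub_apply]; ring)

theorem integral_le (hu : BoundedDensity M m u) : ∫ x, u x ∂volPos ≤ M := by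
  refine (integral_mono_ae hu.integrable hu.integrable_weight ?_).trans hu.weight_le
  filter_upwards [ae_volPos_pos] with x hx
  exact le_mul_of_one_le_left (hu.nonneg x) (by linarith)

theorem sq_weight_le (hu : BoundedDensity M m u) :
    (∫ x, (1 + x) * u x ∂volPos) ^ 2 ≤ M ^ 2 :=
  pow_le_pow_left₀ (integral_nonneg_of_ae hu.weight_nonneg) hu.weight_le 2

theorem eulerStep (hu : BoundedDensity M m u) {K : ℝ → ℝ → ℝ} {N τ : ℝ} (hK : BoundedKernel K N)
    (hτ : 0 ≤ τ) (hτM : τ * (N * M) ≤ 1) : BoundedDensity M m (eulerStep K τ u) := by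
  have hτu : τ * (N * ∫ y, u y ∂volPos) ≤ 1 :=
    (mul_le_mul_of_nonneg_left (mul_le_mul_of_nonneg_left hu.integral_le hK.bound_nonneg)
      hτ).trans hτM
  obtain ⟨h1, h2⟩ := eulerStep_moment_le (φ := fun x => 1 + x) hK hτ hu.measurable hu.nonneg
    hu.integrable (by fun_prop) (fun x hx => by linarith) (fun x _ y _ h => by simpa using h)
    hu.integrable_weight
  obtain ⟨-, h3⟩ := eulerStep_moment_le (φ := fun x => x) hK hτ hu.measurable hu.nonneg
    hu.integrable measurable_id (fun x hx => hx.le) (fun x _ y _ h => h) hu.integrable_moment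
  exact ⟨measurable_eulerStep hK.measurable hu.measurable,
    eulerStep_nonneg hK hτ hu.nonneg hu.integrable hτu, h1, h2.trans hu.weight_le,
    h3.trans hu.moment_le⟩

end BoundedDensity

/-- The weight of a colliding pair `(z, y)` in the balance of particles with size in `E`: sizes
`z > y` create a particle of size `z - y` and consume one of size `z`. -/
noncomputable def balance (E : Set ℝ) (p : ℝ × ℝ) : ℝ :=
  (largerFirst ∩ (fun p : ℝ × ℝ => p.1 - p.2) ⁻¹' E).indicator 1 p
    - ((Prod.fst : ℝ × ℝ → ℝ) ⁻¹' E).indicator 1 p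

/-- The rate of change of the number of particles with size in `E`. -/
noncomputable def weakRate (K : ℝ → ℝ → ℝ) (E : Set ℝ) (u : ℝ → ℝ) : ℝ :=
  ∫ p, balance E p * (K p.1 p.2 * u p.1 * u p.2) ∂(volPos.prod volPos)

theorem measurable_balance {E : Set ℝ} (hE : MeasurableSet E) : Measurable (balance E) :=
  (measurable_one.indicator (measurableSet_largerFirst.inter
    ((by fun_prop : Measurable fun p : ℝ × ℝ => p.1 - p.2) hE))).sub
    (measurable_one.indicator (measurable_fst hE))

theorem abs_balance_le (E : Set ℝ) (p : ℝ × ℝ) : |balance E p| ≤ 1 := by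
  have h : ∀ s : Set (ℝ × ℝ), 0 ≤ s.indicator (1 : ℝ × ℝ → ℝ) p ∧
      s.indicator (1 : ℝ × ℝ → ℝ) p ≤ 1 := fun s =>
    ⟨indicator_nonneg (fun _ _ => zero_le_one) p, indicator_le_self' (fun _ _ => zero_le_one) p⟩
  unfold balance
  rw [abs_le]
  constructor <;> linarith [(h (largerFirst ∩ (fun p : ℝ × ℝ => p.1 - p.2) ⁻¹' E)).1,
    (h (largerFirst ∩ (fun p : ℝ × ℝ => p.1 - p.2) ⁻¹' E)).2,
    (h ((Prod.fst : ℝ × ℝ → ℝ) ⁻¹' E)).1, (h ((Prod.fst : ℝ × ℝ → ℝ) ⁻¹' E)).2]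

theorem integrable_balance_mul {E : Set ℝ} (hE : MeasurableSet E) {H : ℝ × ℝ → ℝ}
    (hH : Integrable H (volPos.prod volPos)) :
    Integrable (fun p => balance E p * H p) (volPos.prod volPos) :=
  hH.bdd_mul (c := 1) (measurable_balance hE).aestronglyMeasurable
    (ae_of_all _ fun p => abs_balance_le E p)

theorem setIntegral_gain_sub_loss {K : ℝ → ℝ → ℝ} {u : ℝ → ℝ} {E : Set ℝ} (hE : MeasurableSet E)
    (h : Integrable (fun p : ℝ × ℝ => K p.1 p.2 * u p.1 * u p.2) (volPos.prod volPos)) :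
    (∫ x in E, gain K u u x ∂volPos) - ∫ x in E, u x * lossRate K u x ∂volPos
      = weakRate K E u := by
  set H : ℝ × ℝ → ℝ := fun p => K p.1 p.2 * u p.1 * u p.2 with hH
  have hA : MeasurableSet (largerFirst ∩ (fun p : ℝ × ℝ => p.1 - p.2) ⁻¹' E) :=
    measurableSet_largerFirst.inter ((by fun_prop : Measurable fun p : ℝ × ℝ => p.1 - p.2) hE)
  have hA' : MeasurableSet ((fun p : ℝ × ℝ => p.1 - p.2) ⁻¹' E) :=
    (by fun_prop : Measurable fun p : ℝ × ℝ => p.1 - p.2) hE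
  have hB : MeasurableSet ((Prod.fst : ℝ × ℝ → ℝ) ⁻¹' E) := measurable_fst hE
  have e1 : ∫ x in E, gain K u u x ∂volPos
      = ∫ p in largerFirst ∩ (fun p : ℝ × ℝ => p.1 - p.2) ⁻¹' E, H p ∂(volPos.prod volPos) := by
    have h1 : Integrable (((fun p : ℝ × ℝ => p.1 - p.2) ⁻¹' E).indicator H)
      (volPos.prod volPos) := h.indicator hA'
    have h2 := integral_shear (((fun p : ℝ × ℝ => p.1 - p.2) ⁻¹' E).indicator H)
    rw [setIntegral_indicator hA', integral_prod _ (integrable_shear h1)] at h2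
    rw [← h2, ← integral_indicator hE]
    congr 1
    ext x
    by_cases hx : x ∈ E
    · rw [indicator_of_mem hx, gain]
      congr 1
      ext y
      rw [indicator_of_mem (by simpa using hx)]
    · rw [indicator_of_notMem hx]
      symm
      refine integral_eq_zero_of_ae (ae_of_all _ fun y => ?_)
      exact indicator_of_notMem (by simpa using hx) _
  have e2 : ∫ x in E, u x * lossRate K u x ∂volPos
      = ∫ p in (Prod.fst : ℝ × ℝ → ℝ) ⁻¹' E, H p ∂(volPos.prod volPos) := by
    rw [← integral_indicator hB, integral_prod _ (h.indicator hB), ← integral_indicator hE]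
    congr 1
    ext x
    by_cases hx : x ∈ E
    · rw [indicator_of_mem hx, lossRate, ← integral_const_mul]
      congr 1
      ext y
      rw [indicator_of_mem (by simpa using hx), hH]
      ring
    · rw [indicator_of_notMem hx]
      symm
      refine integral_eq_zero_of_ae (ae_of_all _ fun y => ?_)
      exact indicator_of_notMem (by simpa using hx) _
  rw [e1, e2, weakRate, ← integral_indicator hA, ← integral_indicator hB,
    ← integral_sub (h.indicator hA) (h.indicator hB)]
  congr 1
  ext p
  have hind : ∀ s : Set (ℝ × ℝ), s.indicator H p = s.indicator 1 p * H p := fun s => by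
    by_cases hp : p ∈ s <;> simp [hp]
  rw [hind, hind, balance, sub_mul]

theorem setIntegral_eulerStep {K : ℝ → ℝ → ℝ} {τ : ℝ} {u : ℝ → ℝ} {E : Set ℝ}
    (hE : MeasurableSet E) (hu : Integrable u volPos)
    (h : Integrable (fun p : ℝ × ℝ => K p.1 p.2 * u p.1 * u p.2) (volPos.prod volPos)) :
    ∫ x in E, eulerStep K τ u x ∂volPos = ∫ x in E, u x ∂volPos + τ * weakRate K E u := by
  have iL := (integrable_mul_lossRate h).integrableOn (s := E)
  have iG := (integrable_gain h).integrableOn (s := E)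
  have heq : eulerStep K τ u = fun x => u x - τ * (u x * lossRate K u x) + τ * gain K u u x := by
    ext x; simp only [eulerStep]; ring
  have i1 : IntegrableOn (fun x => u x - τ * (u x * lossRate K u x)) E volPos :=
    hu.integrableOn.sub (iL.const_mul τ)
  rw [← setIntegral_gain_sub_loss hE h, heq, integral_add i1 (iG.const_mul τ),
    integral_sub hu.integrableOn (iL.const_mul τ), integral_const_mul, integral_const_mul]
  ring

section WeakRate

variable {K : ℝ → ℝ → ℝ} {C M m : ℝ} {u v : ℝ → ℝ}

theorem BoundedDensity.integrable_collision (hu : BoundedDensity M m u)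
    (hKm : Measurable (Function.uncurry K)) (hK0 : ∀ x y, 0 ≤ K x y)
    (hKC : ∀ x > 0, ∀ y > 0, K x y ≤ C * ((1 + x) * (1 + y))) :
    Integrable (fun p : ℝ × ℝ => K p.1 p.2 * u p.1 * u p.2) (volPos.prod volPos) := by
  have h1 := (hu.integrable_weight.mul_prod hu.integrable_weight).const_mul C
  refine h1.mono' ?_ ?_
  · exact ((Measurable.mul hKm (hu.measurable.comp measurable_fst)).mul
      (hu.measurable.comp measurable_snd)).aestronglyMeasurable
  · filter_upwards [ae_prod_volPos_pos] with p hp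
    rw [Real.norm_of_nonneg (mul_nonneg (mul_nonneg (hK0 _ _) (hu.nonneg _)) (hu.nonneg _))]
    have := mul_le_mul_of_nonneg_right (mul_le_mul_of_nonneg_right
        (hKC p.1 hp.1 p.2 hp.2) (hu.nonneg p.1)) (hu.nonneg p.2)
    linarith

theorem BoundedDensity.integral_collision_le (hu : BoundedDensity M m u)
    (hKm : Measurable (Function.uncurry K)) (hK0 : ∀ x y, 0 ≤ K x y) (hC : 0 ≤ C)
    (hKC : ∀ x > 0, ∀ y > 0, K x y ≤ C * ((1 + x) * (1 + y))) :
    ∫ p, K p.1 p.2 * u p.1 * u p.2 ∂(volPos.prod volPos) ≤ C * M ^ 2 := by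
  refine le_trans ?_ (mul_le_mul_of_nonneg_left hu.sq_weight_le hC)
  rw [sq, ← integral_prod_mul, ← integral_const_mul]
  refine integral_mono_ae (hu.integrable_collision hKm hK0 hKC)
    ((hu.integrable_weight.mul_prod hu.integrable_weight).const_mul C) ?_
  filter_upwards [ae_prod_volPos_pos] with p hp
  have := mul_le_mul_of_nonneg_right (mul_le_mul_of_nonneg_right
      (hKC p.1 hp.1 p.2 hp.2) (hu.nonneg p.1)) (hu.nonneg p.2)
  linarith

theorem BoundedDensity.abs_weakRate_le (hu : BoundedDensity M m u)
    (hKm : Measurable (Function.uncurry K)) (hK0 : ∀ x y, 0 ≤ K x y) (hC : 0 ≤ C)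
    (hKC : ∀ x > 0, ∀ y > 0, K x y ≤ C * ((1 + x) * (1 + y))) (E : Set ℝ) :
    |weakRate K E u| ≤ C * M ^ 2 := by
  refine le_trans ?_ (hu.integral_collision_le hKm hK0 hC hKC)
  refine abs_integral_le_integral_abs.trans ?_
  refine integral_mono_of_nonneg (ae_of_all _ fun _ => abs_nonneg _)
    (hu.integrable_collision hKm hK0 hKC) (ae_of_all _ fun p => ?_)
  simp only [abs_mul (balance E p)]
  have h0 := mul_nonneg (mul_nonneg (hK0 p.1 p.2) (hu.nonneg p.1)) (hu.nonneg p.2)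
  rw [abs_of_nonneg h0]
  exact mul_le_of_le_one_left h0 (abs_balance_le E p)

end WeakRate

/-- The kernel cut off at height `n`. -/
def truncKernel (K : ℝ → ℝ → ℝ) (n : ℕ) (x y : ℝ) : ℝ := min (K x y) n

theorem ControlledKernel.boundedKernel_trunc {K : ℝ → ℝ → ℝ} (hK : ControlledKernel K) (n : ℕ) :
    BoundedKernel (truncKernel K n) n :=
  ⟨hK.measurable.min measurable_const, fun x y => le_min (hK.nonneg x y) n.cast_nonneg,
    fun _ _ => min_le_right _ _⟩

theorem abs_truncKernel_sub_le (K : ℝ → ℝ → ℝ) (n : ℕ) (x x' y : ℝ) :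
    |truncKernel K n x y - truncKernel K n x' y| ≤ |K x y - K x' y| := by
  unfold truncKernel
  simpa using abs_min_sub_min_le_max (K x y) n (K x' y) n

/-- Cutting the kernel at level `m` splits both kernels into a common part bounded by `m` and a part
dominated by `ε (1 + x) (1 + y)`. -/
theorem abs_weakRate_trunc_sub_le {K : ℝ → ℝ → ℝ} (hK : ControlledKernel K) {M c : ℝ}
    {u v : ℝ → ℝ} (hu : BoundedDensity M c u) (hv : BoundedDensity M c v) {ε m : ℝ} (hε : 0 ≤ ε)
    (hm0 : 0 ≤ m) (hm : ∀ x > 0, ∀ y > 0, K x y ≤ m + ε * ((1 + x) * (1 + y))) {n : ℕ}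
    (hn : m ≤ n) {E : Set ℝ} (hE : MeasurableSet E) :
    |weakRate (truncKernel K n) E u - weakRate K E v|
      ≤ 2 * m * M * (∫ x, |u x - v x| ∂volPos) + 2 * ε * M ^ 2 := by
  obtain ⟨C, -, hC⟩ := hK.exists_le_mul
  have cu := (hK.boundedKernel_trunc n).integrable_collision hu.integrable hu.integrable
  have cv := hv.integrable_collision hK.measurable hK.nonneg hC
  have hd : Integrable (fun x => |u x - v x|) volPos := (hu.integrable.sub hv.integrable).abs
  have i1 := hd.mul_prod hu.integrable
  have i2 := hv.integrable.mul_prod hd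
  have i3 := hu.integrable_weight.mul_prod hu.integrable_weight
  have i4 := hv.integrable_weight.mul_prod hv.integrable_weight
  have hM := hu.bound_nonneg
  have hpt : ∀ᵐ p ∂(volPos.prod volPos),
      |balance E p * (truncKernel K n p.1 p.2 * u p.1 * u p.2)
        - balance E p * (K p.1 p.2 * v p.1 * v p.2)| ≤
      m * (|u p.1 - v p.1| * u p.2 + v p.1 * |u p.2 - v p.2|)
        + ε * (((1 + p.1) * u p.1) * ((1 + p.2) * u p.2)
          + ((1 + p.1) * v p.1) * ((1 + p.2) * v p.2)) := by
    filter_upwards [ae_prod_volPos_pos] with p hp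
    rw [← mul_sub, abs_mul]
    refine (mul_le_of_le_one_left (abs_nonneg _) (abs_balance_le E p)).trans ?_
    have hKp := hm p.1 hp.1 p.2 hp.2
    have hK0 := hK.nonneg p.1 p.2
    set w := (1 + p.1) * (1 + p.2) with hw
    have hw0 : 0 ≤ ε * w := mul_nonneg hε (mul_nonneg (by linarith [hp.1]) (by linarith [hp.2]))
    set k := min (K p.1 p.2) m with hk
    have hk0 : 0 ≤ k := le_min hK0 hm0
    have hkm : k ≤ m := min_le_right _ _
    have h1 : |K p.1 p.2 - k| ≤ ε * w := by
      rw [abs_of_nonneg (sub_nonneg.2 (min_le_left _ _)), hk]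
      rcases min_cases (K p.1 p.2) m with ⟨h, -⟩ | ⟨h, -⟩ <;> rw [h] <;> linarith
    have h2 : |truncKernel K n p.1 p.2 - k| ≤ ε * w := by
      have h3 : k ≤ truncKernel K n p.1 p.2 := min_le_min_left _ hn
      have h4 : truncKernel K n p.1 p.2 ≤ K p.1 p.2 := min_le_left _ _
      rw [abs_of_nonneg (sub_nonneg.2 h3)]
      have := le_abs_self (K p.1 p.2 - k)
      linarith
    have u1 := hu.nonneg p.1
    have u2 := hu.nonneg p.2
    have v1 := hv.nonneg p.1
    have v2 := hv.nonneg p.2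
    have hsplit : truncKernel K n p.1 p.2 * u p.1 * u p.2 - K p.1 p.2 * v p.1 * v p.2
        = k * ((u p.1 - v p.1) * u p.2 + v p.1 * (u p.2 - v p.2))
          + (truncKernel K n p.1 p.2 - k) * (u p.1 * u p.2)
          + -((K p.1 p.2 - k) * (v p.1 * v p.2)) := by ring
    rw [hsplit]
    refine (abs_add_three _ _ _).trans ?_
    rw [abs_neg, abs_mul k, abs_mul _ (u p.1 * u p.2), abs_mul _ (v p.1 * v p.2),
      abs_of_nonneg hk0, abs_of_nonneg (mul_nonneg u1 u2), abs_of_nonneg (mul_nonneg v1 v2)]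
    have h5 : |(u p.1 - v p.1) * u p.2 + v p.1 * (u p.2 - v p.2)|
        ≤ |u p.1 - v p.1| * u p.2 + v p.1 * |u p.2 - v p.2| := by
      refine (abs_add_le _ _).trans (le_of_eq ?_)
      rw [abs_mul, abs_mul, abs_of_nonneg u2, abs_of_nonneg v1]
    have h6 := mul_le_mul hkm h5 (abs_nonneg _) hm0
    have h7 := mul_le_mul_of_nonneg_right h2 (mul_nonneg u1 u2)
    have h8 := mul_le_mul_of_nonneg_right h1 (mul_nonneg v1 v2)
    have h9 : ε * ((1 + p.1) * u p.1 * ((1 + p.2) * u p.2)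
        + (1 + p.1) * v p.1 * ((1 + p.2) * v p.2))
        = ε * w * (u p.1 * u p.2) + ε * w * (v p.1 * v p.2) := by rw [hw]; ring
    rw [h9]
    linarith
  have i12 := i1.add i2
  have i34 := i3.add i4
  simp only [Pi.add_def] at i12 i34
  unfold weakRate
  rw [← integral_sub (integrable_balance_mul hE cu) (integrable_balance_mul hE cv)]
  refine abs_integral_le_integral_abs.trans ((integral_mono_of_nonneg
    (ae_of_all _ fun _ => abs_nonneg _) ((i12.const_mul m).add (i34.const_mul ε)) hpt).trans ?_)
  simp only [Pi.add_apply]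
  rw [integral_add (i12.const_mul m) (i34.const_mul ε), integral_const_mul, integral_const_mul,
    integral_add i1 i2, integral_add i3 i4,
    integral_prod_mul (fun x => |u x - v x|) u, integral_prod_mul v fun x => |u x - v x|,
    integral_prod_mul (fun x => (1 + x) * u x) fun x => (1 + x) * u x,
    integral_prod_mul (fun x => (1 + x) * v x) fun x => (1 + x) * v x, ← sq, ← sq]
  set d := ∫ x, |u x - v x| ∂volPos with hd_def
  have hd0 : 0 ≤ d := integral_nonneg fun _ => abs_nonneg _
  have g1 := mul_le_mul_of_nonneg_left hu.integral_le hd0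
  have g2 := mul_le_mul_of_nonneg_right hv.integral_le hd0
  have g3 := mul_le_mul_of_nonneg_left (add_le_add g1 g2) hm0
  have g4 := mul_le_mul_of_nonneg_left (add_le_add hu.sq_weight_le hv.sq_weight_le) hε
  linarith

/-! ### The Euler scheme and its limit -/

/-- The time step used with the kernel cut off at height `n` and densities of weighted mass at
most `M`; it is short enough to preserve positivity. -/
noncomputable def timeStep (M : ℝ) (n : ℕ) : ℝ := 1 / ((n + 1) * (M + 1))

theorem timeStep_pos {M : ℝ} (hM : 0 ≤ M) (n : ℕ) : 0 < timeStep M n := by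
  unfold timeStep; positivity

theorem timeStep_mul_le {M : ℝ} (hM : 0 ≤ M) (n : ℕ) : timeStep M n * (n * M) ≤ 1 := by
  unfold timeStep
  rw [div_mul_eq_mul_div, div_le_one (by positivity), one_mul]
  gcongr <;> linarith

theorem tendsto_timeStep (M : ℝ) : Tendsto (timeStep M) atTop (𝓝 0) := by
  have h := (tendsto_one_div_add_atTop_nhds_zero_nat (𝕜 := ℝ)).mul_const (1 / (M + 1))
  rw [zero_mul] at h
  refine h.congr fun n => ?_
  rw [timeStep, div_mul_div_comm, one_mul]

/-- The iterates of the Euler scheme. -/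
noncomputable def eulerIter (K : ℝ → ℝ → ℝ) (M : ℝ) (u₀ : ℝ → ℝ) (n : ℕ) : ℕ → ℝ → ℝ
  | 0 => u₀
  | k + 1 => eulerStep (truncKernel K n) (timeStep M n) (eulerIter K M u₀ n k)

/-- The Euler scheme as a function of continuous time, constant between grid points. -/
noncomputable def eulerApprox (K : ℝ → ℝ → ℝ) (M : ℝ) (u₀ : ℝ → ℝ) (n : ℕ) (t : ℝ) : ℝ → ℝ :=
  eulerIter K M u₀ n ⌊t / timeStep M n⌋₊

section Scheme

variable {K : ℝ → ℝ → ℝ} {M m : ℝ} {u₀ : ℝ → ℝ}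

theorem boundedDensity_eulerIter (hK : ControlledKernel K) (hu : BoundedDensity M m u₀) (n k : ℕ) :
    BoundedDensity M m (eulerIter K M u₀ n k) := by
  induction k with
  | zero => exact hu
  | succ k ih =>
    exact ih.eulerStep (hK.boundedKernel_trunc n) (timeStep_pos hu.bound_nonneg n).le
      (timeStep_mul_le hu.bound_nonneg n)

theorem eulerIter_shift_le (hK : ControlledKernel K) (hu : BoundedDensity M m u₀) (n k : ℕ)
    {h ω : ℝ} (hh : 0 ≤ h) (hω : 0 ≤ ω)
    (hmod : ∀ x > 0, ∀ y > 0, |K (x + h) y - K x y| ≤ ω * ((1 + x) * (1 + y))) :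
    ∫ x, |eulerIter K M u₀ n k (x + h) - eulerIter K M u₀ n k x| ∂volPos
      ≤ ∫ x, |u₀ (x + h) - u₀ x| ∂volPos + k * timeStep M n * (2 * ω * M ^ 2) := by
  have hτ := (timeStep_pos hu.bound_nonneg n).le
  induction k with
  | zero => simp [eulerIter]
  | succ k ih =>
    have hb := boundedDensity_eulerIter hK hu n k
    have hτu : timeStep M n * (n * ∫ y, eulerIter K M u₀ n k y ∂volPos) ≤ 1 :=
      (mul_le_mul_of_nonneg_left (mul_le_mul_of_nonneg_left hb.integral_le n.cast_nonneg)
        hτ).trans (timeStep_mul_le hu.bound_nonneg n)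
    have h1 := eulerStep_shift_le (hK.boundedKernel_trunc n) hτ hh hω hb.nonneg hb.integrable
      hb.integrable_weight hτu
      fun x hx y hy => (abs_truncKernel_sub_le K n _ _ y).trans (hmod x hx y hy)
    have h2 := mul_le_mul_of_nonneg_left hb.sq_weight_le
      (mul_nonneg (mul_nonneg zero_le_two hτ) hω)
    push_cast
    simp only [eulerIter]
    linarith

theorem eulerIter_dist_le (hK : ControlledKernel K) (hu : BoundedDensity M m u₀) {C : ℝ}
    (hC0 : 0 ≤ C) (hC : ∀ x > 0, ∀ y > 0, K x y ≤ C * ((1 + x) * (1 + y))) (n k j : ℕ) :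
    ∫ x, |eulerIter K M u₀ n (k + j) x - eulerIter K M u₀ n k x| ∂volPos
      ≤ 2 * C * M ^ 2 * (j * timeStep M n) := by
  have hτ := (timeStep_pos hu.bound_nonneg n).le
  induction j with
  | zero => simp
  | succ j ih =>
    have hb := boundedDensity_eulerIter hK hu n
    have h1 := eulerStep_dist_le (C := C) (hK.boundedKernel_trunc n) hτ (hb (k + j)).nonneg
      (hb (k + j)).integrable (hb (k + j)).integrable_weight
      fun x hx y hy => (min_le_left _ _).trans (hC x hx y hy)
    have h2 := mul_le_mul_of_nonneg_left (hb (k + j)).sq_weight_le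
      (mul_nonneg (mul_nonneg zero_le_two hτ) hC0)
    have i1 : Integrable (fun x => |eulerIter K M u₀ n (k + j + 1) x
      - eulerIter K M u₀ n (k + j) x|) volPos :=
      ((hb (k + j + 1)).integrable.sub (hb (k + j)).integrable).abs
    have i2 : Integrable (fun x => |eulerIter K M u₀ n (k + j) x - eulerIter K M u₀ n k x|)
      volPos := ((hb (k + j)).integrable.sub (hb k).integrable).abs
    have h3 : ∫ x, |eulerIter K M u₀ n (k + (j + 1)) x - eulerIter K M u₀ n k x| ∂volPos
        ≤ ∫ x, (|eulerIter K M u₀ n (k + j + 1) x - eulerIter K M u₀ n (k + j) x|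
          + |eulerIter K M u₀ n (k + j) x - eulerIter K M u₀ n k x|) ∂volPos :=
      integral_mono_of_nonneg (ae_of_all _ fun _ => abs_nonneg _) (i1.add i2)
        (ae_of_all _ fun x => abs_sub_le _ _ _)
    rw [integral_add i1 i2] at h3
    simp only [eulerIter] at h3 ⊢
    push_cast
    linarith

theorem eulerApprox_dist_le (hK : ControlledKernel K) (hu : BoundedDensity M m u₀) {C : ℝ}
    (hC0 : 0 ≤ C) (hC : ∀ x > 0, ∀ y > 0, K x y ≤ C * ((1 + x) * (1 + y))) (n : ℕ) {s t : ℝ}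
    (hs : 0 ≤ s) (ht : 0 ≤ t) :
    ∫ x, |eulerApprox K M u₀ n s x - eulerApprox K M u₀ n t x| ∂volPos
      ≤ 2 * C * M ^ 2 * (|s - t| + timeStep M n) := by
  have hτ := timeStep_pos hu.bound_nonneg n
  have key : ∀ s t : ℝ, 0 ≤ s → s ≤ t →
      ∫ x, |eulerApprox K M u₀ n t x - eulerApprox K M u₀ n s x| ∂volPos
        ≤ 2 * C * M ^ 2 * ((t - s) + timeStep M n) := by
    intro s t hs hst
    have hfl : ⌊s / timeStep M n⌋₊ ≤ ⌊t / timeStep M n⌋₊ :=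
      Nat.floor_le_floor (by gcongr)
    obtain ⟨j, hj⟩ := Nat.exists_eq_add_of_le hfl
    unfold eulerApprox
    rw [hj]
    refine (eulerIter_dist_le hK hu hC0 hC n _ j).trans ?_
    refine mul_le_mul_of_nonneg_left ?_ (by positivity)
    have h1 : (⌊t / timeStep M n⌋₊ : ℝ) * timeStep M n ≤ t :=
      (le_div_iff₀ hτ).1 (Nat.floor_le (div_nonneg (hs.trans hst) hτ.le))
    have h2 : s < (⌊s / timeStep M n⌋₊ + 1) * timeStep M n :=
      (div_lt_iff₀ hτ).1 (Nat.lt_floor_add_one _)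
    rw [hj] at h1
    push_cast at h1
    linarith
  rcases le_total s t with h | h
  · have h1 := key s t hs h
    simp only [abs_sub_comm (eulerApprox K M u₀ n s _)]
    rwa [abs_sub_comm, abs_of_nonneg (sub_nonneg.2 h)]
  · rw [abs_of_nonneg (sub_nonneg.2 h)]
    exact key t s ht h

/-- The Euler approximations at a fixed time form a totally bounded set in `L¹`. -/
theorem totallyBounded_eulerApprox (hK : ControlledKernel K) (hu : BoundedDensity M m u₀)
    {t : ℝ} (ht : 0 ≤ t) :
    TotallyBounded (range fun n =>
      ((boundedDensity_eulerIter hK hu n ⌊t / timeStep M n⌋₊).integrable.toL1 _ : L1Pos)) := by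
  have hae : ∀ n, ((boundedDensity_eulerIter hK hu n ⌊t / timeStep M n⌋₊).integrable.toL1 _
      : L1Pos) =ᵐ[volPos] eulerApprox K M u₀ n t := fun n => Integrable.coeFn_toL1 _
  have hb : ∀ n, BoundedDensity M m (eulerApprox K M u₀ n t) :=
    fun n => boundedDensity_eulerIter hK hu n _
  have hw : ∀ n, (fun x => (1 + x) * |((boundedDensity_eulerIter hK hu n
      ⌊t / timeStep M n⌋₊).integrable.toL1 _ : L1Pos) x|)
      =ᵐ[volPos] fun x => (1 + x) * eulerApprox K M u₀ n t x := fun n => by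
    filter_upwards [hae n] with x hx
    rw [hx, abs_of_nonneg ((hb n).nonneg x)]
  refine totallyBounded_of_shift (M := M) ?_ ?_ ?_
  · rintro _ ⟨n, rfl⟩
    exact (hb n).integrable_weight.congr (hw n).symm
  · rintro _ ⟨n, rfl⟩
    rw [integral_congr_ae (hw n)]
    exact (hb n).weight_le
  · intro ε hε
    obtain ⟨δ₁, hδ₁, h₁⟩ := exists_shift_integral_le hu.integrable (half_pos hε)
    set ω := ε / (4 * (t + 1) * (M ^ 2 + 1)) with hω
    have hω0 : 0 < ω := by positivity
    obtain ⟨δ₂, hδ₂, h₂⟩ := hK.modulus ω hω0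
    refine ⟨min δ₁ δ₂, lt_min hδ₁ hδ₂, ?_⟩
    rintro _ ⟨n, rfl⟩ h h0 hlt
    have hτ := timeStep_pos hu.bound_nonneg n
    have e1 : ∫ x, |((boundedDensity_eulerIter hK hu n
        ⌊t / timeStep M n⌋₊).integrable.toL1 _ : L1Pos) (x + h)
          - ((boundedDensity_eulerIter hK hu n
        ⌊t / timeStep M n⌋₊).integrable.toL1 _ : L1Pos) x| ∂volPos
        = ∫ x, |eulerApprox K M u₀ n t (x + h) - eulerApprox K M u₀ n t x| ∂volPos := by
      refine integral_congr_ae ?_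
      filter_upwards [hae n, ae_volPos_shift h0.le (hae n)] with x hx hxh
      rw [hx, hxh]
    have e2 := eulerIter_shift_le hK hu n ⌊t / timeStep M n⌋₊ h0.le hω0.le
      (h₂ h h0 (hlt.trans_le (min_le_right _ _)))
    have e3 := h₁ h h0 (hlt.trans_le (min_le_left _ _))
    have e4 : (⌊t / timeStep M n⌋₊ : ℝ) * timeStep M n ≤ t :=
      (le_div_iff₀ hτ).1 (Nat.floor_le (div_nonneg ht hτ.le))
    have e5 : (⌊t / timeStep M n⌋₊ : ℝ) * timeStep M n * (2 * ω * M ^ 2) ≤ ε / 2 := by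
      calc (⌊t / timeStep M n⌋₊ : ℝ) * timeStep M n * (2 * ω * M ^ 2)
          ≤ (t + 1) * (2 * ω * (M ^ 2 + 1)) := by
            refine mul_le_mul (by linarith) ?_ (by positivity) (by positivity)
            exact mul_le_mul_of_nonneg_left (by linarith) (by positivity)
        _ = ε / 2 := by rw [hω]; field_simp; ring
    refine e1.le.trans (e2.trans ?_)
    linarith

/-- A subsequence of the Euler approximations converges in `L¹` at every time, to a jointly
measurable density that is Lipschitz continuous in time and obeys the same bounds. -/
theorem exists_limit_eulerApprox (hK : ControlledKernel K) (hu : BoundedDensity M m u₀) :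
    ∃ φ : ℕ → ℕ, StrictMono φ ∧ ∃ f : ℝ → ℝ → ℝ, Measurable (Function.uncurry f) ∧
      (∀ t, BoundedDensity M m (f t)) ∧
      (∃ L : ℝ, 0 ≤ L ∧ ∀ s t, 0 ≤ s → 0 ≤ t → ∫ x, |f s x - f t x| ∂volPos ≤ L * |s - t|) ∧
      ∀ t, 0 ≤ t → Tendsto (fun n => ∫ x, |eulerApprox K M u₀ (φ n) t x - f t x| ∂volPos)
        atTop (𝓝 0) := by
  obtain ⟨C, hC0, hC⟩ := hK.exists_le_mul
  have hb : ∀ n t, BoundedDensity M m (eulerApprox K M u₀ n t) :=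
    fun n t => boundedDensity_eulerIter hK hu n _
  let F : ℕ → ℝ → L1Pos := fun n t => (hb n t).integrable.toL1 _
  have hF : ∀ n t, F n t =ᵐ[volPos] eulerApprox K M u₀ n t :=
    fun n t => Integrable.coeFn_toL1 _
  set L := 2 * C * M ^ 2 with hLdef
  have hL : 0 ≤ L := by positivity
  have hdist : ∀ n s t, 0 ≤ s → 0 ≤ t → dist (F n s) (F n t) ≤ L * (|s - t| + timeStep M n) := by
    intro n s t hs ht
    refine le_trans (le_of_eq ?_) (eulerApprox_dist_le hK hu hC0 hC n hs ht)
    rw [dist_L1Pos_eq]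
    refine integral_congr_ae ?_
    filter_upwards [hF n s, hF n t] with x h1 h2
    rw [h1, h2]
  obtain ⟨φ, hφ, G, hG⟩ := exists_subseq_tendsto_of_totallyBounded (F := F)
    (tendsto_timeStep M) hL
    (fun t ht => totallyBounded_eulerApprox hK hu ht) hdist
  have hGL : ∀ s t, 0 ≤ s → 0 ≤ t → dist (G s) (G t) ≤ L * |s - t| := by
    intro s t hs ht
    have h1 : Tendsto (fun n => L * (|s - t| + timeStep M (φ n))) atTop (𝓝 (L * (|s - t| + 0))) :=
      (((tendsto_timeStep M).comp hφ.tendsto_atTop).const_add _).const_mul _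
    rw [add_zero] at h1
    exact le_of_tendsto_of_tendsto' ((hG s hs).dist (hG t ht)) h1
      fun n => hdist (φ n) s t hs ht
  have hcont : Continuous fun t => G (max t 0) := by
    have : LipschitzWith (Real.toNNReal L) fun t => G (max t 0) := by
      refine LipschitzWith.of_dist_le_mul fun s t => ?_
      rw [Real.coe_toNNReal _ hL]
      refine (hGL _ _ (le_max_right _ _) (le_max_right _ _)).trans
        (mul_le_mul_of_nonneg_left ?_ hL)
      simpa [Real.dist_eq] using abs_max_sub_max_le_max s 0 t 0
    exact this.continuous
  have hclosed : ∀ φ' : ℝ → ℝ, Measurable φ' → (∀ x, 0 < x → 0 ≤ φ' x) → ∀ c : ℝ,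
      (∀ n t, Integrable (fun x => φ' x * eulerApprox K M u₀ n t x) volPos) →
      (∀ n t, ∫ x, φ' x * eulerApprox K M u₀ n t x ∂volPos ≤ c) → ∀ t, 0 ≤ t →
      (∀ᵐ x ∂volPos, 0 ≤ G t x) ∧ Integrable (fun x => φ' x * G t x) volPos ∧
      ∫ x, φ' x * G t x ∂volPos ≤ c := by
    intro w hw hw0 c hi hc t ht
    have hae : ∀ n, (fun x => w x * F (φ n) t x)
        =ᵐ[volPos] fun x => w x * eulerApprox K M u₀ (φ n) t x := fun n => by
      filter_upwards [hF (φ n) t] with x hx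
      rw [hx]
    refine moment_le_of_tendsto hw hw0 (hG t ht) (fun n => ?_)
      (fun n => (hi _ _).congr (hae n).symm)
      (fun n => (integral_congr_ae (hae n)).trans_le (hc _ _))
    filter_upwards [hF (φ n) t] with x hx
    rw [hx]
    exact (hb _ _).nonneg x
  have hGw := hclosed (fun x => 1 + x) (by fun_prop) (fun x hx => by linarith) M
    (fun n t => (hb n t).integrable_weight) fun n t => (hb n t).weight_le
  have hGm := hclosed (fun x => x) measurable_id (fun x hx => hx.le) m
    (fun n t => (hb n t).integrable_moment) fun n t => (hb n t).moment_le
  obtain ⟨f, hfm, hf0, hf⟩ := exists_measurable_representative hcont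
    fun t => (hGw (max t 0) (le_max_right _ _)).1
  have hf' : ∀ t, 0 ≤ t → f t =ᵐ[volPos] G t := fun t ht => by
    have := hf t
    rwa [max_eq_left ht] at this
  refine ⟨φ, hφ, f, hfm, fun t => ⟨hfm.of_uncurry_left, hf0 t, ?_, ?_, ?_⟩,
    ⟨L, hL, fun s t hs ht => ?_⟩, fun t ht => ?_⟩
  · refine (hGw (max t 0) (le_max_right _ _)).2.1.congr ?_
    filter_upwards [hf t] with x hx
    rw [hx]
  · refine le_of_eq_of_le (integral_congr_ae ?_) (hGw (max t 0) (le_max_right _ _)).2.2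
    filter_upwards [hf t] with x hx
    rw [hx]
  · refine le_of_eq_of_le (integral_congr_ae ?_) (hGm (max t 0) (le_max_right _ _)).2.2
    filter_upwards [hf t] with x hx
    rw [hx]
  · refine le_of_eq_of_le ?_ (hGL s t hs ht)
    rw [dist_L1Pos_eq]
    refine integral_congr_ae ?_
    filter_upwards [hf' s hs, hf' t ht] with x h1 h2
    rw [h1, h2]
  · refine (tendsto_iff_dist_tendsto_zero.1 (hG t ht)).congr fun n => ?_
    rw [dist_L1Pos_eq]
    refine integral_congr_ae ?_
    filter_upwards [hF (φ n) t, hf' t ht] with x h1 h2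
    rw [h1, h2]

/-- The weak form of the scheme, as a time integral over the grid. -/
theorem setIntegral_eulerIter (hK : ControlledKernel K) (hu : BoundedDensity M m u₀) {E : Set ℝ}
    (hE : MeasurableSet E) (n k : ℕ)
    (hint : ∀ a b, IntervalIntegrable
      (fun s => weakRate (truncKernel K n) E (eulerApprox K M u₀ n s)) volume a b) :
    ∫ x in E, eulerIter K M u₀ n k x ∂volPos = ∫ x in E, u₀ x ∂volPos
      + ∫ s in (0 : ℝ)..(k * timeStep M n),
        weakRate (truncKernel K n) E (eulerApprox K M u₀ n s) := by
  have hτ := timeStep_pos hu.bound_nonneg n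
  induction k with
  | zero => simp [eulerIter]
  | succ k ih =>
    have hb := boundedDensity_eulerIter hK hu n k
    have hstep := setIntegral_eulerStep (K := truncKernel K n) (τ := timeStep M n) hE hb.integrable
      ((hK.boundedKernel_trunc n).integrable_collision hb.integrable hb.integrable)
    have hle : (k : ℝ) * timeStep M n ≤ ((k + 1 : ℕ) : ℝ) * timeStep M n := by
      push_cast; linarith
    have hpiece : ∫ s in ((k : ℝ) * timeStep M n)..(((k + 1 : ℕ) : ℝ) * timeStep M n),
        weakRate (truncKernel K n) E (eulerApprox K M u₀ n s)
        = timeStep M n * weakRate (truncKernel K n) E (eulerIter K M u₀ n k) := by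
      rw [intervalIntegral.integral_of_le hle, integral_Ioc_eq_integral_Ioo,
        setIntegral_congr_fun (g := fun _ => weakRate (truncKernel K n) E (eulerIter K M u₀ n k))
          measurableSet_Ioo, setIntegral_const, Real.volume_real_Ioo_of_le hle]
      · push_cast
        rw [smul_eq_mul]
        ring
      · intro s hs
        have hfl : ⌊s / timeStep M n⌋₊ = k := by
          have hs0 : 0 ≤ s := (by positivity : (0 : ℝ) ≤ k * timeStep M n).trans hs.1.le
          rw [Nat.floor_eq_iff (by positivity)]
          refine ⟨(le_div_iff₀ hτ).2 hs.1.le, (div_lt_iff₀ hτ).2 ?_⟩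
          have := hs.2
          push_cast at this
          exact this
        simp only [eulerApprox, hfl]
    rw [← intervalIntegral.integral_add_adjacent_intervals (hint 0 (k * timeStep M n))
      (hint _ _), hpiece, ← add_assoc, ← ih]
    exact hstep

theorem tendsto_weakRate (hK : ControlledKernel K) {φ : ℕ → ℕ} (hφ : StrictMono φ)
    {u : ℕ → ℝ → ℝ} {v : ℝ → ℝ} (hu : ∀ n, BoundedDensity M m (u n)) (hv : BoundedDensity M m v)
    (h : Tendsto (fun n => ∫ x, |u n x - v x| ∂volPos) atTop (𝓝 0)) {E : Set ℝ}
    (hE : MeasurableSet E) :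
    Tendsto (fun n => weakRate (truncKernel K (φ n)) E (u n)) atTop (𝓝 (weakRate K E v)) := by
  rw [Metric.tendsto_nhds]
  intro ε hε
  obtain ⟨c, hc0, hc⟩ := hK.le_add (ε / (4 * (M ^ 2 + 1))) (by positivity)
  have h1 : Tendsto (fun n => 2 * c * M * ∫ x, |u n x - v x| ∂volPos) atTop (𝓝 0) := by
    simpa using h.const_mul (2 * c * M)
  filter_upwards [h1.eventually (gt_mem_nhds (half_pos hε)),
    (tendsto_natCast_atTop_atTop.comp hφ.tendsto_atTop).eventually (eventually_ge_atTop c)]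
    with n hn1 hn2
  rw [Real.dist_eq]
  have h2 := abs_weakRate_trunc_sub_le hK (hu n) hv
    (by positivity : 0 ≤ ε / (4 * (M ^ 2 + 1))) hc0 hc hn2 hE
  have h3 : 2 * (ε / (4 * (M ^ 2 + 1))) * M ^ 2 ≤ ε / 2 := by
    calc 2 * (ε / (4 * (M ^ 2 + 1))) * M ^ 2
        ≤ 2 * (ε / (4 * (M ^ 2 + 1))) * (M ^ 2 + 1) := by gcongr; linarith
      _ = ε / 2 := by field_simp; ring
  linarith

/-- The equation for a controlled kernel, integrated over time and over an arbitrary measurable set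
of sizes. -/
theorem exists_weak_solution (hK : ControlledKernel K) (hu : BoundedDensity M m u₀) :
    ∃ f : ℝ → ℝ → ℝ, Measurable (Function.uncurry f) ∧ (∀ t, BoundedDensity M m (f t)) ∧
      (∃ L : ℝ, 0 ≤ L ∧ ∀ s t, 0 ≤ s → 0 ≤ t → ∫ x, |f s x - f t x| ∂volPos ≤ L * |s - t|) ∧
      ∀ t, 0 ≤ t → ∀ E, MeasurableSet E →
        ∫ x in E, f t x ∂volPos
          = ∫ x in E, u₀ x ∂volPos + ∫ s in (0 : ℝ)..t, weakRate K E (f s) := by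
  obtain ⟨φ, hφ, f, hfm, hfb, hfL, hlim⟩ := exists_limit_eulerApprox hK hu
  refine ⟨f, hfm, hfb, hfL, fun t ht E hE => ?_⟩
  obtain ⟨C, hC0, hC⟩ := hK.exists_le_mul
  have hb : ∀ n t, BoundedDensity M m (eulerApprox K M u₀ n t) :=
    fun n t => boundedDensity_eulerIter hK hu n _
  let q : ℕ → ℝ → ℝ := fun n s => weakRate (truncKernel K n) E (eulerApprox K M u₀ n s)
  have hqm : ∀ n, Measurable (q n) := fun n =>
    (measurable_from_top (f := fun k : ℕ =>
      weakRate (truncKernel K n) E (eulerIter K M u₀ n k))).comp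
      (Nat.measurable_floor.comp (measurable_id.div_const (timeStep M n)))
  have hqb : ∀ n s, |q n s| ≤ C * M ^ 2 := fun n s =>
    (hb n s).abs_weakRate_le (hK.boundedKernel_trunc n).measurable
      (hK.boundedKernel_trunc n).nonneg hC0
      (fun x hx y hy => (min_le_left _ _).trans (hC x hx y hy)) E
  have hqi : ∀ n a b, IntervalIntegrable (q n) volume a b := fun n a b =>
    (intervalIntegrable_const (c := C * M ^ 2)).mono_fun' (hqm n).aestronglyMeasurable
      (ae_of_all _ fun s => hqb n s)
  have hint : Tendsto (fun n => ∫ s in (0 : ℝ)..t, q (φ n) s) atTop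
      (𝓝 (∫ s in (0 : ℝ)..t, weakRate K E (f s))) := by
    refine intervalIntegral.tendsto_integral_filter_of_dominated_convergence
      (fun _ => C * M ^ 2) (Eventually.of_forall fun n => (hqm _).aestronglyMeasurable)
      (Eventually.of_forall fun n => ae_of_all _ fun s _ => hqb _ s)
      intervalIntegrable_const (ae_of_all _ fun s hs => ?_)
    rw [uIoc_of_le ht] at hs
    exact tendsto_weakRate hK hφ (fun n => hb (φ n) s) (hfb s) (hlim s hs.1.le) hE
  have hrem : Tendsto (fun n => ∫ s in ((⌊t / timeStep M (φ n)⌋₊ : ℝ) * timeStep M (φ n))..t,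
      q (φ n) s) atTop (𝓝 0) := by
    have h1 : Tendsto (fun n => C * M ^ 2 * timeStep M (φ n)) atTop (𝓝 0) := by
      simpa using ((tendsto_timeStep M).comp hφ.tendsto_atTop).const_mul (C * M ^ 2)
    refine squeeze_zero_norm (fun n => ?_) h1
    have hτ := timeStep_pos hu.bound_nonneg (φ n)
    refine (intervalIntegral.norm_integral_le_of_norm_le_const fun s _ => hqb (φ n) s).trans ?_
    refine mul_le_mul_of_nonneg_left ?_ (by positivity)
    have h2 : (⌊t / timeStep M (φ n)⌋₊ : ℝ) * timeStep M (φ n) ≤ t :=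
      (le_div_iff₀ hτ).1 (Nat.floor_le (div_nonneg ht hτ.le))
    have h3 : t < (⌊t / timeStep M (φ n)⌋₊ + 1) * timeStep M (φ n) :=
      (div_lt_iff₀ hτ).1 (Nat.lt_floor_add_one _)
    rw [abs_of_nonneg (sub_nonneg.2 h2)]
    linarith
  have hL : Tendsto (fun n => ∫ x in E, eulerApprox K M u₀ (φ n) t x ∂volPos) atTop
      (𝓝 (∫ x in E, f t x ∂volPos)) := by
    rw [tendsto_iff_norm_sub_tendsto_zero]
    refine squeeze_zero (fun _ => norm_nonneg _) (fun n => ?_) (hlim t ht)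
    have i1 := (hb (φ n) t).integrable
    have i2 := (hfb t).integrable
    rw [← integral_sub i1.integrableOn i2.integrableOn]
    exact (norm_integral_le_integral_norm _).trans
      (setIntegral_le_integral (i1.sub i2).abs (ae_of_all _ fun _ => abs_nonneg _))
  refine tendsto_nhds_unique hL ?_
  have hR := (hint.sub hrem).const_add (∫ x in E, u₀ x ∂volPos)
  rw [sub_zero] at hR
  refine hR.congr fun n => ?_
  have h1 := setIntegral_eulerIter hK hu hE (φ n) ⌊t / timeStep M (φ n)⌋₊ (hqi (φ n))
  have h2 := intervalIntegral.integral_add_adjacent_intervals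
    (hqi (φ n) 0 (⌊t / timeStep M (φ n)⌋₊ * timeStep M (φ n)))
    (hqi (φ n) (⌊t / timeStep M (φ n)⌋₊ * timeStep M (φ n)) t)
  simp only [eulerApprox, q] at h1 h2 ⊢
  rw [h1, ← h2]
  ring

end Scheme

/-! ### From the weak form to mild solutions -/

theorem integrable_volPosWeighted_iff {g : ℝ → ℝ} :
    Integrable g volPosWeighted ↔ Integrable (fun x => (1 + x) * g x) volPos := by
  unfold volPosWeighted
  rw [integrable_withDensity_iff_integrable_smul' (by fun_prop)
    (ae_of_all _ fun x => ENNReal.ofReal_lt_top)]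
  refine integrable_congr ?_
  filter_upwards [ae_volPos_pos] with x hx
  rw [ENNReal.toReal_ofReal (by linarith), smul_eq_mul]

theorem integral_volPosWeighted (g : ℝ → ℝ) :
    ∫ x, g x ∂volPosWeighted = ∫ x, (1 + x) * g x ∂volPos := by
  unfold volPosWeighted
  rw [integral_withDensity_eq_integral_toReal_smul (by fun_prop)
    (ae_of_all _ fun x => ENNReal.ofReal_lt_top)]
  refine integral_congr_ae ?_
  filter_upwards [ae_volPos_pos] with x hx
  rw [ENNReal.toReal_ofReal (by linarith), smul_eq_mul]

/-- Every element of the positive cone has a representative that is Borel measurable and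
non-negative everywhere. -/
theorem MemX01Pos.exists_boundedDensity {f₀ : ℝ → ℝ} (h : MemX01Pos f₀) :
    ∃ u₀ : ℝ → ℝ, u₀ =ᵐ[volPos] f₀ ∧
      BoundedDensity (∫ x, (1 + x) * u₀ x ∂volPos) (∫ x, x * u₀ x ∂volPos) u₀ := by
  have hi := integrable_volPosWeighted_iff.1 h.1
  have hm : AEMeasurable f₀ volPos := by
    have h1 : AEMeasurable (fun x => (1 + x)⁻¹ * ((1 + x) * f₀ x)) volPos :=
      (by fun_prop : Measurable fun x : ℝ => (1 + x)⁻¹).aemeasurable.mul hi.1.aemeasurable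
    refine h1.congr ?_
    filter_upwards [ae_volPos_pos] with x hx
    have : (1 + x) ≠ 0 := by linarith
    field_simp
  have hu : (fun x => max (hm.mk f₀ x) 0) =ᵐ[volPos] f₀ := by
    filter_upwards [hm.ae_eq_mk, h.2] with x hx hx0
    rw [← hx, max_eq_left hx0]
  refine ⟨fun x => max (hm.mk f₀ x) 0, hu, hm.measurable_mk.max measurable_const,
    fun x => le_max_right _ _, hi.congr ?_, le_rfl, le_rfl⟩
  filter_upwards [hu] with x hx
  rw [hx]

section Curve

variable {M m L : ℝ} {f : ℝ → ℝ → ℝ}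

theorem continuousOn_toL1 (hb : ∀ t, BoundedDensity M m (f t)) (hL : 0 ≤ L)
    (hf : ∀ s t, 0 ≤ s → 0 ≤ t → ∫ x, |f s x - f t x| ∂volPos ≤ L * |s - t|) :
    ContinuousOn (fun t => ((hb t).integrable.toL1 (f t) : L1Pos)) (Ici 0) := by
  refine LipschitzOnWith.continuousOn (K := Real.toNNReal L)
    (LipschitzOnWith.of_dist_le_mul fun s hs t ht => ?_)
  rw [Real.coe_toNNReal _ hL, dist_L1Pos_eq, Real.dist_eq]
  refine le_of_eq_of_le (integral_congr_ae ?_) (hf s t hs ht)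
  filter_upwards [Integrable.coeFn_toL1 (hb s).integrable,
    Integrable.coeFn_toL1 (hb t).integrable] with x h1 h2
  rw [h1, h2]

theorem dist_toL1_volPosWeighted {g₁ g₂ : ℝ → ℝ} (h₁ : Integrable g₁ volPosWeighted)
    (h₂ : Integrable g₂ volPosWeighted) :
    dist (h₁.toL1 g₁ : X01) (h₂.toL1 g₂) = ∫ x, (1 + x) * |g₁ x - g₂ x| ∂volPos := by
  rw [L1.dist_eq_integral_dist, ← integral_volPosWeighted]
  refine integral_congr_ae ?_
  filter_upwards [Integrable.coeFn_toL1 h₁, Integrable.coeFn_toL1 h₂] with x h1 h2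
  rw [h1, h2, Real.dist_eq]

/-- Continuity in `L¹` and boundedness in `X_{0,1}` give strong measurability in `X_{0,1}`: the
curve restricted to sizes below `n` is continuous there, and converges to the curve as `n → ∞`. -/
theorem aestronglyMeasurable_toX01 (hb : ∀ t, BoundedDensity M m (f t)) (hL : 0 ≤ L)
    (hf : ∀ s t, 0 ≤ s → 0 ≤ t → ∫ x, |f s x - f t x| ∂volPos ≤ L * |s - t|) :
    AEStronglyMeasurable (fun t => ((integrable_volPosWeighted_iff.2
      (hb t).integrable_weight).toL1 (f t) : X01)) (volume.restrict (Ici 0)) := by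
  have hi : ∀ t, Integrable (f t) volPosWeighted :=
    fun t => integrable_volPosWeighted_iff.2 (hb t).integrable_weight
  have hin : ∀ (n : ℕ) t, Integrable ((Iic (n : ℝ)).indicator (f t)) volPosWeighted :=
    fun n t => (hi t).indicator measurableSet_Iic
  refine aestronglyMeasurable_of_tendsto_ae atTop
    (f := fun (n : ℕ) t => ((hin n t).toL1 _ : X01)) (fun n => ?_) (ae_of_all _ fun t => ?_)
  · refine ContinuousOn.aestronglyMeasurable ?_ measurableSet_Ici
    have hLn : 0 ≤ (1 + (n : ℝ)) * L := by positivity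
    refine LipschitzOnWith.continuousOn (K := Real.toNNReal ((1 + n) * L))
      (LipschitzOnWith.of_dist_le_mul fun s hs t ht => ?_)
    rw [Real.coe_toNNReal _ hLn, dist_toL1_volPosWeighted, Real.dist_eq, mul_assoc]
    refine le_trans ?_ (mul_le_mul_of_nonneg_left (hf s t hs ht)
      (by positivity : (0 : ℝ) ≤ 1 + n))
    rw [← integral_const_mul]
    refine integral_mono_of_nonneg ?_
      (((hb s).integrable.sub (hb t).integrable).abs.const_mul _) ?_
    · filter_upwards [ae_volPos_pos] with x hx
      exact mul_nonneg (by linarith) (abs_nonneg _)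
    · filter_upwards [ae_volPos_pos] with x hx
      by_cases hxn : x ∈ Iic (n : ℝ)
      · have hxn' : x ≤ n := hxn
        rw [indicator_of_mem hxn, indicator_of_mem hxn]
        exact mul_le_mul_of_nonneg_right (by linarith) (abs_nonneg _)
      · rw [indicator_of_notMem hxn, indicator_of_notMem hxn, sub_zero, abs_zero, mul_zero]
        exact mul_nonneg (by positivity) (abs_nonneg _)
  · rw [tendsto_iff_dist_tendsto_zero]
    simp only [dist_toL1_volPosWeighted]
    rw [← integral_zero ℝ ℝ (μ := volPos)]
    refine tendsto_integral_of_dominated_convergence (fun x => (1 + x) * f t x) (fun n => ?_)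
      (hb t).integrable_weight (fun n => ?_) (ae_of_all _ fun x => ?_)
    · have h1 := ((hb t).measurable.indicator (measurableSet_Iic (a := (n : ℝ)))).sub
        (hb t).measurable
      have h2 : Measurable fun x : ℝ => 1 + x := by fun_prop
      exact (h2.mul h1.abs).aestronglyMeasurable
    · filter_upwards [ae_volPos_pos] with x hx
      rw [Real.norm_of_nonneg (mul_nonneg (by linarith) (abs_nonneg _))]
      refine mul_le_mul_of_nonneg_left ?_ (by linarith)
      have h0 := (hb t).nonneg x
      by_cases hxn : x ∈ Iic (n : ℝ)
      · rw [indicator_of_mem hxn, sub_self, abs_zero]; exact h0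
      · rw [indicator_of_notMem hxn, zero_sub, abs_neg, abs_of_nonneg h0]
    · refine tendsto_const_nhds.congr' ?_
      filter_upwards [eventually_ge_atTop ⌈x⌉₊] with n hn
      rw [indicator_of_mem (mem_Iic.2 (Nat.ceil_le.1 hn)), sub_self, abs_zero, mul_zero]

theorem memLp_toX01 (hb : ∀ t, BoundedDensity M m (f t)) (hL : 0 ≤ L)
    (hf : ∀ s t, 0 ≤ s → 0 ≤ t → ∫ x, |f s x - f t x| ∂volPos ≤ L * |s - t|) :
    MemLp (fun t => ((integrable_volPosWeighted_iff.2
      (hb t).integrable_weight).toL1 (f t) : X01)) ⊤ (volume.restrict (Ici 0)) := by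
  refine memLp_top_of_bound (aestronglyMeasurable_toX01 hb hL hf) M (ae_of_all _ fun t => ?_)
  have hi : Integrable (f t) volPosWeighted :=
    integrable_volPosWeighted_iff.2 (hb t).integrable_weight
  rw [L1.norm_eq_integral_norm]
  refine le_of_eq_of_le ?_ (hb t).weight_le
  rw [← integral_volPosWeighted]
  refine integral_congr_ae ?_
  filter_upwards [Integrable.coeFn_toL1 hi] with x h1
  rw [h1, Real.norm_of_nonneg ((hb t).nonneg x)]

end Curve

section TimeIntegral

variable {ν : Measure ℝ} {H : ℝ × ℝ × ℝ → ℝ}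

theorem integrable_time_prod [IsFiniteMeasure ν] (hH : Measurable H) {c : ℝ}
    (hi : ∀ s, Integrable (fun p => H (s, p)) (volPos.prod volPos))
    (hc : ∀ s, ∫ p, ‖H (s, p)‖ ∂(volPos.prod volPos) ≤ c) :
    Integrable H (ν.prod (volPos.prod volPos)) := by
  refine (integrable_prod_iff hH.aestronglyMeasurable).2 ⟨ae_of_all _ hi, ?_⟩
  refine (integrable_const c).mono' ?_ (ae_of_all _ fun s => ?_)
  · exact hH.norm.stronglyMeasurable.integral_prod_right'.aestronglyMeasurable
  · rw [Real.norm_of_nonneg (integral_nonneg fun _ => norm_nonneg _)]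
    exact hc s

theorem ae_integrable_time_size [SFinite ν]
    (h : Integrable H (ν.prod (volPos.prod volPos))) :
    ∀ᵐ x ∂volPos, Integrable (fun p : ℝ × ℝ => H (p.2, x, p.1)) (volPos.prod ν) := by
  have h1 := (measurePreserving_prodAssoc volPos volPos ν).symm.integrable_comp_of_integrable
    h.swap
  exact h1.prod_right_ae

theorem integrable_inner [SFinite ν] (h : Integrable H (ν.prod (volPos.prod volPos))) :
    Integrable (fun q : ℝ × ℝ => ∫ y, H (q.1, q.2, y) ∂volPos) (ν.prod volPos) :=
  ((measurePreserving_prodAssoc ν volPos volPos).integrable_comp_of_integrable h).integral_prod_left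

theorem integrable_prod_restrict [SFinite ν] {J : ℝ × ℝ → ℝ}
    (h : Integrable J (ν.prod volPos)) (E : Set ℝ) :
    Integrable J (ν.prod (volPos.restrict E)) := by
  have : ν.prod (volPos.restrict E) = (ν.prod volPos).restrict (univ ×ˢ E) := by
    rw [← Measure.prod_restrict, Measure.restrict_univ]
  rw [this]
  exact h.restrict

end TimeIntegral

/-- The weak form over all measurable sets of sizes yields the pointwise integrated equation. -/
theorem mild_of_weak {K : ℝ → ℝ → ℝ} (hK : ControlledKernel K) {M m : ℝ} {u₀ : ℝ → ℝ}
    (hu₀ : Integrable u₀ volPos) {f : ℝ → ℝ → ℝ} (hfm : Measurable (Function.uncurry f))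
    (hb : ∀ t, BoundedDensity M m (f t)) {t : ℝ} (ht : 0 ≤ t)
    (hweak : ∀ E, MeasurableSet E → ∫ x in E, f t x ∂volPos
      = ∫ x in E, u₀ x ∂volPos + ∫ s in (0 : ℝ)..t, weakRate K E (f s)) :
    (∀ᵐ x ∂volPos, Integrable (fun p : ℝ × ℝ => K x p.1 * f p.2 x * f p.2 p.1)
      (volPos.prod (volume.restrict (Ioo 0 t)))) ∧
    (∀ᵐ x ∂volPos, Integrable (fun p : ℝ × ℝ => K (x + p.1) p.1 * f p.2 (x + p.1) * f p.2 p.1)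
      (volPos.prod (volume.restrict (Ioo 0 t)))) ∧
    ∀ᵐ x ∂volPos, f t x = u₀ x
      + (∫ s in Ioo 0 t, ∫ y, K (x + y) y * f s (x + y) * f s y ∂volPos)
      - ∫ s in Ioo 0 t, ∫ y, K x y * f s x * f s y ∂volPos := by
  obtain ⟨C, hC0, hC⟩ := hK.exists_le_mul
  have hcoll : ∀ s, Integrable (fun p : ℝ × ℝ => K p.1 p.2 * f s p.1 * f s p.2)
      (volPos.prod volPos) := fun s => (hb s).integrable_collision hK.measurable hK.nonneg hC
  have hpos : ∀ s x y, 0 ≤ K x y * f s x * f s y := fun s x y =>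
    mul_nonneg (mul_nonneg (hK.nonneg _ _) ((hb s).nonneg _)) ((hb s).nonneg _)
  have hle : ∀ s, ∫ p, K p.1 p.2 * f s p.1 * f s p.2 ∂(volPos.prod volPos) ≤ C * M ^ 2 :=
    fun s => (hb s).integral_collision_le hK.measurable hK.nonneg hC0 hC
  let ν : Measure ℝ := volume.restrict (Ioo 0 t)
  let HL : ℝ × ℝ × ℝ → ℝ := fun q => K q.2.1 q.2.2 * f q.1 q.2.1 * f q.1 q.2.2
  let HG : ℝ × ℝ × ℝ → ℝ := fun q =>
    K (q.2.1 + q.2.2) q.2.2 * f q.1 (q.2.1 + q.2.2) * f q.1 q.2.2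
  have hLm : Measurable HL :=
    ((hK.measurable.comp measurable_snd).mul
      (hfm.comp (by fun_prop : Measurable fun q : ℝ × ℝ × ℝ => (q.1, q.2.1)))).mul
      (hfm.comp (by fun_prop : Measurable fun q : ℝ × ℝ × ℝ => (q.1, q.2.2)))
  have hGm : Measurable HG :=
    hLm.comp (by fun_prop : Measurable fun q : ℝ × ℝ × ℝ => (q.1, q.2.1 + q.2.2, q.2.2))
  have hLi : Integrable HL (ν.prod (volPos.prod volPos)) := by
    refine integrable_time_prod hLm hcoll (c := C * M ^ 2) fun s => ?_
    refine le_of_eq_of_le (integral_congr_ae (ae_of_all _ fun p => ?_)) (hle s)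
    exact Real.norm_of_nonneg (hpos s p.1 p.2)
  have hGi : Integrable HG (ν.prod (volPos.prod volPos)) := by
    refine integrable_time_prod hGm (fun s => integrable_shear (hcoll s)) (c := C * M ^ 2)
      fun s => ?_
    refine le_trans (le_of_eq (integral_congr_ae (ae_of_all _ fun p => ?_)))
      ((integral_shear_le (hcoll s) fun p => hpos s p.1 p.2).trans (hle s))
    exact Real.norm_of_nonneg (hpos s _ _)
  refine ⟨ae_integrable_time_size hLi, ae_integrable_time_size hGi, ?_⟩
  have jL := integrable_inner hLi
  have jG := integrable_inner hGi
  have kL : Integrable (fun x => ∫ s, ∫ y, HL (s, x, y) ∂volPos ∂ν) volPos := jL.integral_prod_right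
  have kG : Integrable (fun x => ∫ s, ∫ y, HG (s, x, y) ∂volPos ∂ν) volPos := jG.integral_prod_right
  refine Integrable.ae_eq_of_forall_setIntegral_eq (f t)
    (fun x => u₀ x + (∫ s, ∫ y, HG (s, x, y) ∂volPos ∂ν) - ∫ s, ∫ y, HL (s, x, y) ∂volPos ∂ν)
    (hb t).integrable ((hu₀.add kG).sub kL) fun E hE _ => ?_
  have hJL := integrable_prod_restrict jL E
  have hJG := integrable_prod_restrict jG E
  have hw : ∀ s, weakRate K E (f s) = (∫ x in E, ∫ y, HG (s, x, y) ∂volPos ∂volPos)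
      - ∫ x in E, ∫ y, HL (s, x, y) ∂volPos ∂volPos := by
    intro s
    rw [← setIntegral_gain_sub_loss hE (hcoll s)]
    congr 1
    refine integral_congr_ae (ae_of_all _ fun x => ?_)
    simp only [lossRate, HL, ← integral_const_mul]
    exact integral_congr_ae (ae_of_all _ fun y => by ring)
  have i1 : IntegrableOn (fun x => u₀ x + ∫ s, ∫ y, HG (s, x, y) ∂volPos ∂ν) E volPos :=
    (hu₀.add kG).integrableOn
  have sG := integral_integral_swap (f := fun s x => ∫ y, HG (s, x, y) ∂volPos) hJG
  have sL := integral_integral_swap (f := fun s x => ∫ y, HL (s, x, y) ∂volPos) hJL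
  rw [hweak E hE, intervalIntegral.integral_of_le ht, integral_Ioc_eq_integral_Ioo,
    integral_congr_ae (ae_of_all _ hw), integral_sub hJG.integral_prod_left hJL.integral_prod_left,
    sG, sL, integral_sub i1 kL.integrableOn,
    integral_add hu₀.integrableOn kG.integrableOn]
  ring

theorem theorem2p1
    (K : ℝ → ℝ → ℝ) (r : ℝ → ℝ) (α : ℝ → ℝ → ℝ) (A : ℝ)
    -- the kernel is of product type, non-negative and symmetric
    (hK : ∀ x, 0 ≤ x → ∀ y, 0 ≤ y → K x y = r x * r y + α x y)
    (hr_cont : ContinuousOn r (Ici 0))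
    (hr_nonneg : ∀ x, 0 ≤ x → 0 ≤ r x)
    (hα_cont : ContinuousOn (Function.uncurry α) (Ici 0 ×ˢ Ici 0))
    (hα_nonneg : ∀ x, 0 ≤ x → ∀ y, 0 ≤ y → 0 ≤ α x y)
    (hα_symm : ∀ x, 0 ≤ x → ∀ y, 0 ≤ y → α x y = α y x)
    (hA : 0 < A)
    (hα_le : ∀ x, 1 ≤ x → ∀ y, 1 ≤ y → α x y ≤ A * r x * r y)
    -- the kernel is strictly subquadratic
    (hK_sub : ∀ R : ℝ, 1 ≤ R →
      Tendsto (fun y : ℝ => sSup ((fun x : ℝ => K x y / y) '' Icc 0 R)) atTop (𝓝 0))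
    (f₀ : ℝ → ℝ) (hf₀ : MemX01Pos f₀) :
    ∃ f : ℝ → ℝ → ℝ, IsMildSolution K f₀ ⊤ f ∧
      ∀ t : ℝ, 0 ≤ t → ∫ x in Ioi 0, x * f t x ≤ ∫ x in Ioi 0, x * f₀ x := by
  have hcont : ContinuousOn (Function.uncurry K) (Ici 0 ×ˢ Ici 0) := by
    have h1 : ContinuousOn (fun p : ℝ × ℝ => r p.1 * r p.2 + Function.uncurry α p)
        (Ici 0 ×ˢ Ici 0) :=
      ((hr_cont.comp continuousOn_fst fun p hp => hp.1).mul
        (hr_cont.comp continuousOn_snd fun p hp => hp.2)).add hα_cont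
    exact h1.congr fun p hp => hK p.1 hp.1 p.2 hp.2
  have hnonneg : ∀ x, 0 ≤ x → ∀ y, 0 ≤ y → 0 ≤ K x y := fun x hx y hy => by
    rw [hK x hx y hy]
    exact add_nonneg (mul_nonneg (hr_nonneg x hx) (hr_nonneg y hy)) (hα_nonneg x hx y hy)
  have hcK := ControlledKernel.of_continuousOn hcont hnonneg
    (kernel_le_of_subquadratic hK hr_cont hr_nonneg hcont hα_nonneg hα_symm hA hα_le hK_sub)
  obtain ⟨u₀, hu₀, hub⟩ := hf₀.exists_boundedDensity
  obtain ⟨f, hfm, hb, ⟨L, hL, hfL⟩, hweak⟩ := exists_weak_solution hcK hub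
  have htime : timeIco ⊤ = Ici 0 := by
    ext t
    exact ⟨fun h => h.1, fun h => ⟨h, EReal.coe_lt_top t⟩⟩
  have hmild := fun t (ht : 0 ≤ t) =>
    mild_of_weak hcK hub.integrable hfm hb ht (hweak t ht)
  have hKeq : ∀ x y : ℝ, 0 < x → 0 < y → K (max x 0) (max y 0) = K x y := fun x y hx hy => by
    rw [max_eq_left hx.le, max_eq_left hy.le]
  have hfst : ∀ ν : Measure ℝ, SFinite ν → ∀ᵐ p ∂(volPos.prod ν), 0 < p.1 := fun ν _ =>
    Measure.quasiMeasurePreserving_fst.ae ae_volPos_pos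
  refine ⟨f, ⟨hfm.aestronglyMeasurable, ?_, ?_, ?_, ?_, ?_, ?_⟩, ?_⟩
  · exact fun t _ => ⟨integrable_volPosWeighted_iff.2 (hb t).integrable_weight,
      ae_of_all _ (hb t).nonneg⟩
  · rw [htime]
    exact ⟨_, fun t _ => Integrable.coeFn_toL1 (hb t).integrable, continuousOn_toL1 hb hL hfL⟩
  · rw [htime]
    exact ⟨_, fun t _ => Integrable.coeFn_toL1 (integrable_volPosWeighted_iff.2
      (hb t).integrable_weight), memLp_toX01 hb hL hfL⟩
  · rw [htime]
    intro t ht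
    filter_upwards [(hmild t ht).1, ae_volPos_pos] with x hx hx0
    refine hx.congr ?_
    filter_upwards [hfst (volume.restrict (Ioo 0 t)) inferInstance] with p hp
    rw [hKeq _ _ hx0 hp]
  · rw [htime]
    intro t ht
    filter_upwards [(hmild t ht).2.1, ae_volPos_pos] with x hx hx0
    refine hx.congr ?_
    filter_upwards [hfst (volume.restrict (Ioo 0 t)) inferInstance] with p hp
    rw [hKeq _ _ (add_pos hx0 hp) hp]
  · rw [htime]
    intro t ht
    filter_upwards [(hmild t ht).2.2, ae_volPos_pos, hu₀] with x hx hx0 hxu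
    rw [hx, hxu]
    refine congrArg₂ (· - ·) (congrArg (f₀ x + ·) ?_) ?_
    all_goals
      refine integral_congr_ae (ae_of_all _ fun s => integral_congr_ae (μ := volPos) ?_)
      filter_upwards [ae_volPos_pos] with y hy
    · rw [hKeq _ _ (add_pos hx0 hy) hy]
    · rw [hKeq _ _ hx0 hy]
  · intro t _
    refine (hb t).moment_le.trans (le_of_eq (integral_congr_ae ?_))
    filter_upwards [hu₀] with x hx
    rw [hx]
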